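/- Let $d\in\mathbb N$ and let $K\langle d\rangle$ be the non-commutative unitary group: the unital $*$-algebra over $\mathbb C$ generated by non-commuting indeterminates $x_{kl},x_{kl}^*$ ($1\le k,l\le d$) subject to $XX^*=E=X^*X$, where $X=(x_{kl})$, $(X^*)_{kl}=x_{lk}^*$ and $E$ is the $d\times d$ identity matrix, with counit the unital $*$-homomorphism $\delta:K\langle d\rangle\to\mathbb C$, $\delta(x_{kl})=\delta_{kl}$. Let $(\rho,\eta,\Psi)$ be a Schürmann triple of $(K\langle d\rangle,\delta)$ on a complex pre-Hilbert space $D$ with completion $\overline D$, that is: $\rho:K\langle d\rangle\to B(\overline D)$ is a unital $*$-homomorphism; $\eta:K\langle d\rangle\to D$ is linear and surjective with $\eta(ab)=\rho(a)\eta(b)+\eta(a)\delta(b)$; $\Psi:K\langle d\rangle\to\mathbb C$ is linear with $\Psi(b^*)=\overline{\Psi(b)}$, $\Psi(1)=0$ and $\Psi(b^*b)\ge 0$ for $b\in\ker\delta$; and $\langle\eta(a),\eta(b)\rangle=\Psi\big((a-\delta(a)1)^*(b-\delta(b)1)\big)$ for all $a,b$. Assume $\rho(x_{kl})=\delta_{kl}\,\mathrm{id}$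 for all $k,l$. Let $\Gamma=\bigoplus_{n\ge0}H^{\otimes n}$ be the full Fock space over $H=L^2(\mathbb R_+,\overline D)$ with vacuum vector $\Omega=(1,0,0,\dots)$, creation operators $A^*(h)$ (with $A^*(h)\Omega=h$, $A^*(h)(h_1\otimes\dots\otimes h_n)=h\otimes h_1\otimes\dots\otimes h_n$) and annihilation operators $A(h)=A^*(h)^*$. For $0\le r\le s$ let $g_{r,s}$ be the $d\times d$ matrix over $B(\Gamma)$ with entries $$(g_{r,s})_{kl}=\delta_{kl}\,\mathrm{id}+A^*(\chi_{[r,s]}\otimes\eta(x_{kl}))+A(\chi_{[r,s]}\otimes\eta(x_{kl}^*))+(s-r)\Psi(x_{kl})\,\mathrm{id},$$ and for a partition $\alpha=\{r=t_1<\dots<t_{n+1}=s\}$ of $[r,s]$ put $\Theta_\alpha=g_{t_1,t_2}g_{t_2,t_3}\cdots g_{t_n,t_{n+1}}$. Then there is exactly one family $(f_{r,s})_{0\le r\le s}$ of unital $*$-homomorphisms $f_{r,s}:K\langle d\rangle\to B(\Gamma)$ such that $f_{r,r}=\delta(\cdot)\,\mathrm{id}$ for $r\ge0$ and, for all $0\le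 r<s$ and all $k,l$, $f_{r,s}(x_{kl})$ is the operator norm limit of the net $(\Theta_\alpha)_{kl}$ over the partitions $\alpha$ of $[r,s]$ ordered by inclusion. This family (the free Lévy process over $K\langle d\rangle$ with generator $\Psi$) is cyclic: if $\mathcal A\subseteq B(\Gamma)$ denotes the unital $*$-subalgebra generated by all $f_{r,s}(b)$, $0\le r\le s$, $b\in K\langle d\rangle$, then $\mathcal A\,\Omega=\{a\Omega: a\in\mathcal A\}$ is dense in $\Gamma$. -/

import Mathlib

open scoped TensorProduct ComplexOrder
open MeasureTheory Filter Topology UniformSpace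

universe u

noncomputable section

/-! ## The non-commutative unitary group -/

namespace UnitaryGroup

/-- Free generators: `(k, l, false)` stands for `x_{kl}` and `(k, l, true)` for `x_{kl}^*`. -/
abbrev Gen (d : ℕ) : Type := Fin d × Fin d × Bool

/-- The unitary relations `(X X^*)_{kl} = δ_{kl}` and `(X^* X)_{kl} = δ_{kl}`. -/
inductive Rel (d : ℕ) : FreeAlgebra ℂ (Gen d) → FreeAlgebra ℂ (Gen d) → Prop
  | mul_star (k l : Fin d) : Rel d
      (∑ p, FreeAlgebra.ι ℂ (k, p, false) * FreeAlgebra.ι ℂ (l, p, true))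
      (if k = l then 1 else 0)
  | star_mul (k l : Fin d) : Rel d
      (∑ p, FreeAlgebra.ι ℂ (p, k, true) * FreeAlgebra.ι ℂ (p, l, false))
      (if k = l then 1 else 0)

/-- `A` with reversed multiplication and complex-conjugated scalars; a homomorphism
`A →ₐ[ℂ] ConjOp A` is the same thing as an antilinear antimultiplicative map `A → A`. -/
def ConjOp (A : Type*) : Type _ := Aᵐᵒᵖ

instance {A : Type*} [Ring A] : Ring (ConjOp A) := inferInstanceAs (Ring Aᵐᵒᵖ)

instance {A : Type*} [Ring A] [Algebra ℂ A] : Algebra ℂ (ConjOp A) :=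
  ((algebraMap ℂ Aᵐᵒᵖ).comp (starRingEnd ℂ)).toAlgebra' fun c x =>
    Algebra.commutes (A := Aᵐᵒᵖ) (starRingEnd ℂ c) x

end UnitaryGroup

open UnitaryGroup

/-- The non-commutative unitary group `K⟨d⟩`: the unital `*`-algebra over `ℂ` generated by
non-commuting indeterminates `x_{kl}`, `x_{kl}^*` subject to `X X^* = E = X^* X`. -/
def KD (d : ℕ) : Type := RingQuot (Rel d)

namespace KD

variable {d : ℕ}

instance : Ring (KD d) := inferInstanceAs (Ring (RingQuot (Rel d)))

instance : Algebra ℂ (KD d) := inferInstanceAs (Algebra ℂ (RingQuot (Rel d)))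

/-- The quotient map from the free algebra. -/
def mk : FreeAlgebra ℂ (Gen d) →ₐ[ℂ] KD d := RingQuot.mkAlgHom ℂ (Rel d)

/-- A generator of `K⟨d⟩`. -/
def gen (g : Gen d) : KD d := mk (FreeAlgebra.ι ℂ g)

theorem gen_mul_star (k l : Fin d) :
    ∑ p, gen (k, p, false) * gen (l, p, true) = (if k = l then 1 else 0 : KD d) := by
  have h := RingQuot.mkAlgHom_rel ℂ (Rel.mul_star (d := d) k l)
  change mk _ = mk _ at h
  rw [map_sum] at h
  simp only [map_mul] at h
  refine h.trans ?_
  split_ifs <;> simp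

theorem gen_star_mul (k l : Fin d) :
    ∑ p, gen (p, k, true) * gen (p, l, false) = (if k = l then 1 else 0 : KD d) := by
  have h := RingQuot.mkAlgHom_rel ℂ (Rel.star_mul (d := d) k l)
  change mk _ = mk _ at h
  rw [map_sum] at h
  simp only [map_mul] at h
  refine h.trans ?_
  split_ifs <;> simp

/-- Algebra homomorphisms out of `K⟨d⟩`. -/
def liftAlg {A : Type*} [Ring A] [Algebra ℂ A] (u : Gen d → A)
    (h₁ : ∀ k l, ∑ p, u (k, p, false) * u (l, p, true) = if k = l then 1 else 0)
    (h₂ : ∀ k l, ∑ p, u (p, k, true) * u (p, l, false) = if k = l then 1 else 0) :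
    KD d →ₐ[ℂ] A :=
  RingQuot.liftAlgHom ℂ ⟨FreeAlgebra.lift ℂ u, by
    intro a b h
    cases h with
    | mul_star k l =>
      simp only [map_sum, map_mul, FreeAlgebra.lift_ι_apply]
      rw [h₁]; split_ifs <;> simp
    | star_mul k l =>
      simp only [map_sum, map_mul, FreeAlgebra.lift_ι_apply]
      rw [h₂]; split_ifs <;> simp⟩

@[simp] theorem liftAlg_gen {A : Type*} [Ring A] [Algebra ℂ A] (u : Gen d → A) (h₁ h₂)
    (g : Gen d) : liftAlg u h₁ h₂ (gen g) = u g := by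
  unfold liftAlg gen mk
  erw [RingQuot.liftAlgHom_mkAlgHom_apply]
  simp

theorem algHom_ext {A : Type*} [Semiring A] [Algebra ℂ A] {f g : KD d →ₐ[ℂ] A}
    (h : ∀ i, f (gen i) = g (gen i)) : f = g :=
  RingQuot.ringQuot_ext' ℂ _ _ (FreeAlgebra.hom_ext (funext h))

/-- The involution, as a homomorphism into the opposite conjugate algebra. -/
def starHom : KD d →ₐ[ℂ] ConjOp (KD d) :=
  liftAlg (fun g => (MulOpposite.op (gen (g.1, g.2.1, !g.2.2)) : (KD d)ᵐᵒᵖ))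
    (fun k l => by
      apply MulOpposite.unop_injective
      have h := gen_mul_star l k
      refine Eq.trans ?_ (h.trans ?_)
      · refine (map_sum (MulOpposite.opAddEquiv (α := KD d)).symm _ _).trans ?_
        rfl
      · by_cases hkl : k = l
        · subst hkl; simp only [if_true]; rfl
        · rw [if_neg hkl, if_neg (Ne.symm hkl)]; rfl)
    (fun k l => by
      apply MulOpposite.unop_injective
      have h := gen_star_mul l k
      refine Eq.trans ?_ (h.trans ?_)
      · refine (map_sum (MulOpposite.opAddEquiv (α := KD d)).symm _ _).trans ?_
        rfl
      · by_cases hkl : k = l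
        · subst hkl; simp only [if_true]; rfl
        · rw [if_neg hkl, if_neg (Ne.symm hkl)]; rfl)

/-- The underlying map of the involution. -/
def starFun (a : KD d) : KD d := MulOpposite.unop (starHom a : (KD d)ᵐᵒᵖ)

theorem starFun_gen (g : Gen d) : starFun (gen g) = gen (g.1, g.2.1, !g.2.2) :=
  congrArg MulOpposite.unop (liftAlg_gen (A := ConjOp (KD d)) _ _ _ g)

theorem starFun_add (a b : KD d) : starFun (a + b) = starFun a + starFun b := by
  unfold starFun; rw [map_add]; rfl

theorem starFun_mul (a b : KD d) : starFun (a * b) = starFun b * starFun a := by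
  unfold starFun; rw [map_mul]; rfl

theorem starFun_algebraMap (c : ℂ) :
    starFun (algebraMap ℂ (KD d) c) = algebraMap ℂ (KD d) (starRingEnd ℂ c) := by
  unfold starFun; rw [AlgHom.commutes]; rfl

/-- The involution applied twice, as an algebra homomorphism. -/
def starStar : KD d →ₐ[ℂ] KD d where
  toFun a := starFun (starFun a)
  map_one' := by
    have h := starFun_algebraMap (d := d) 1
    simp only [map_one] at h
    rw [h, h]
  map_zero' := by
    have h := starFun_algebraMap (d := d) 0
    simp only [map_zero] at h
    rw [h, h]
  map_add' a b := by rw [starFun_add, starFun_add]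
  map_mul' a b := by rw [starFun_mul, starFun_mul]
  commutes' c := by rw [starFun_algebraMap, starFun_algebraMap, Complex.conj_conj]

theorem starFun_starFun (a : KD d) : starFun (starFun a) = a := by
  have h : starStar = AlgHom.id ℂ (KD d) := algHom_ext fun g => by
    change starFun (starFun (gen g)) = gen g
    rw [starFun_gen, starFun_gen]; simp
  exact DFunLike.congr_fun h a

instance : StarRing (KD d) where
  star := starFun
  star_involutive := starFun_starFun
  star_mul := starFun_mul
  star_add := starFun_add

instance : StarModule ℂ (KD d) where
  star_smul c a := by
    change starFun (c • a) = star c • starFun a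
    rw [Algebra.smul_def, starFun_mul, starFun_algebraMap, ← Algebra.commutes,
      ← Algebra.smul_def]
    rfl

/-- The matrix `X` of generators `x_{kl}`; the starred generators are `star (x k l)`. -/
def x (k l : Fin d) : KD d := gen (k, l, false)

theorem star_x (k l : Fin d) : star (x k l) = gen (k, l, true) := starFun_gen _

section lift

variable {A : Type*} [Ring A] [StarRing A] [Algebra ℂ A]

/-- The algebra homomorphism given by `x_{kl} ↦ u_{kl}`, `x_{kl}^* ↦ u_{kl}^*`. -/
def liftStarAlg (u : Matrix (Fin d) (Fin d) A) (h₁ : u * u.conjTranspose = 1)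
    (h₂ : u.conjTranspose * u = 1) : KD d →ₐ[ℂ] A :=
  liftAlg (fun g => if g.2.2 then star (u g.1 g.2.1) else u g.1 g.2.1)
    (fun k l => by
      have h := congrFun (congrFun h₁ k) l
      simpa [Matrix.mul_apply, Matrix.conjTranspose_apply, Matrix.one_apply] using h)
    (fun k l => by
      have h := congrFun (congrFun h₂ k) l
      simpa [Matrix.mul_apply, Matrix.conjTranspose_apply, Matrix.one_apply] using h)

theorem liftStarAlg_gen (u : Matrix (Fin d) (Fin d) A) (h₁ h₂) (g : Gen d) :
    liftStarAlg u h₁ h₂ (gen g) = if g.2.2 then star (u g.1 g.2.1) else u g.1 g.2.1 :=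
  liftAlg_gen _ _ _ g

variable [StarModule ℂ A]

/-- A unitary matrix over a unital `*`-algebra defines a unital `*`-homomorphism on `K⟨d⟩`. -/
def lift (u : Matrix (Fin d) (Fin d) A) (h₁ : u * u.conjTranspose = 1)
    (h₂ : u.conjTranspose * u = 1) : KD d →⋆ₐ[ℂ] A :=
  let φ : KD d →ₐ[ℂ] A := liftStarAlg u h₁ h₂
  { φ with
    map_star' := fun a => by
      let ψ : KD d →ₐ[ℂ] A :=
        { toFun := fun a => star (φ (star a))
          map_one' := by simp
          map_zero' := by simp
          map_add' := fun a b => by simp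
          map_mul' := fun a b => by simp
          commutes' := fun c => by
            rw [Algebra.algebraMap_eq_smul_one, star_smul, star_one, map_smul, map_one,
              star_smul, star_star, star_one, ← Algebra.algebraMap_eq_smul_one] }
      have h : φ = ψ := algHom_ext fun g => by
        change φ (gen g) = star (φ (starFun (gen g)))
        rw [starFun_gen]
        simp only [φ, liftStarAlg_gen]
        cases g.2.2 <;> simp
      have h' : φ (star a) = star (φ (star (star a))) := DFunLike.congr_fun h (star a)
      rw [star_star] at h'
      exact h' }

@[simp] theorem lift_x (u : Matrix (Fin d) (Fin d) A) (h₁ h₂) (k l : Fin d) :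
    lift u h₁ h₂ (x k l) = u k l :=
  (liftStarAlg_gen u h₁ h₂ (k, l, false)).trans (by simp)

end lift

theorem x_mul_star_x (k l : Fin d) :
    ∑ p, x k p * star (x l p) = (if k = l then 1 else 0 : KD d) := by
  simp only [star_x]; exact gen_mul_star k l

theorem star_x_mul_x (k l : Fin d) :
    ∑ p, star (x p k) * x p l = (if k = l then 1 else 0 : KD d) := by
  simp only [star_x]; exact gen_star_mul k l

/-- The counit `δ(x_{kl}) = δ_{kl}`. -/
def counit : KD d →⋆ₐ[ℂ] ℂ := lift 1 (by simp) (by simp)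

theorem counit_x (k l : Fin d) : counit (x k l) = if k = l then 1 else 0 := by
  simp [counit, Matrix.one_apply]

end KD

/-! ## Generators and Schürmann triples -/

/-- A generator: a hermitian linear functional vanishing at `1` that is positive on the
kernel of the counit. -/
structure IsGenerator {d : ℕ} (Ψ : KD d →ₗ[ℂ] ℂ) : Prop where
  hermitian : ∀ b, Ψ (star b) = star (Ψ b)
  map_one : Ψ 1 = 0
  nonneg : ∀ b, KD.counit b = 0 → 0 ≤ Ψ (star b * b)

/-- A Schürmann triple `(ρ, η, Ψ)` on the pre-Hilbert space `D`; `ρ` acts by adjointable, i.e.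
bounded, operators on the completion of `D`. -/
structure SchurmannTriple (d : ℕ) (D : Type*) [NormedAddCommGroup D]
    [InnerProductSpace ℂ D] where
  ρ : KD d →⋆ₐ[ℂ] (Completion D →L[ℂ] Completion D)
  η : KD d →ₗ[ℂ] D
  Ψ : KD d →ₗ[ℂ] ℂ
  η_surjective : Function.Surjective η
  η_mul : ∀ a b, (η (a * b) : Completion D)
    = ρ a (η b : Completion D) + KD.counit b • (η a : Completion D)
  isGenerator : IsGenerator Ψ
  inner_η : ∀ a b, inner ℂ (η a) (η b)
    = Ψ (star (a - KD.counit a • 1) * (b - KD.counit b • 1))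

/-! ## The full Fock space -/

/-- A bundled complex Hilbert space, used for the recursion that defines tensor powers. -/
structure HilbertBundle : Type (u + 1) where
  carrier : Type u
  [normedAddCommGroup : NormedAddCommGroup carrier]
  [innerProductSpace : InnerProductSpace ℂ carrier]
  [completeSpace : CompleteSpace carrier]

attribute [instance] HilbertBundle.normedAddCommGroup HilbertBundle.innerProductSpace
  HilbertBundle.completeSpace

/-- `H^{⊗0} = ℂ` (as the one-dimensional Euclidean space in the universe of `H`) and
`H^{⊗(n+1)} = H ⊗ H^{⊗n}`, the completed tensor product. -/
def hilbertPowBundle (H : Type u) [NormedAddCommGroup H] [InnerProductSpace ℂ H] :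
    ℕ → HilbertBundle.{u}
  | 0 => ⟨EuclideanSpace ℂ PUnit.{u + 1}⟩
  | n + 1 => ⟨Completion (H ⊗[ℂ] (hilbertPowBundle H n).carrier)⟩

/-- The Hilbert space tensor power `H^{⊗n}`. -/
abbrev HilbertPow (H : Type u) [NormedAddCommGroup H] [InnerProductSpace ℂ H] (n : ℕ) : Type u :=
  (hilbertPowBundle H n).carrier

/-- The full Fock space `Γ(H)`, the Hilbert space direct sum of all `H^{⊗n}`. -/
abbrev FullFock (H : Type u) [NormedAddCommGroup H] [InnerProductSpace ℂ H] : Type u :=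
  lp (fun n => HilbertPow H n) 2

namespace FullFock

variable {H : Type u} [NormedAddCommGroup H] [InnerProductSpace ℂ H]

/-- The scalar `c` as an element of `H^{⊗0}`. -/
def scalar (c : ℂ) : HilbertPow H 0 :=
  (EuclideanSpace.single PUnit.unit c : EuclideanSpace ℂ PUnit.{u + 1})

/-- The vacuum vector `Ω = (1, 0, 0, …)`. -/
def vacuum : FullFock H := lp.single 2 0 (scalar 1)

/-- `tens h y = h ⊗ y ∈ H^{⊗(n+1)}`. -/
def tens (h : H) {n : ℕ} (y : HilbertPow H n) : HilbertPow H (n + 1) :=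
  ((h ⊗ₜ[ℂ] y : H ⊗[ℂ] HilbertPow H n) : Completion (H ⊗[ℂ] HilbertPow H n))

theorem tens_add (h : H) {n : ℕ} (y z : HilbertPow H n) :
    tens h (y + z) = tens h y + tens h z := by
  unfold tens
  rw [TensorProduct.tmul_add]
  exact Completion.coe_add _ _

theorem tens_smul (h : H) {n : ℕ} (c : ℂ) (y : HilbertPow H n) :
    tens h (c • y) = c • tens h y := by
  unfold tens
  rw [TensorProduct.tmul_smul]
  exact Completion.coe_smul _ _

theorem inner_tens (h g : H) {n : ℕ} (y z : HilbertPow H n) :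
    inner ℂ (tens h y) (tens g z) = inner ℂ h g * inner ℂ y z :=
  (Completion.inner_coe _ _).trans (TensorProduct.inner_tmul _ _ _ _ _)

theorem norm_tens (h : H) {n : ℕ} (y : HilbertPow H n) : ‖tens h y‖ = ‖h‖ * ‖y‖ :=
  (Completion.norm_coe _).trans (TensorProduct.norm_tmul _ _)

/-- The coordinates of `h ⊗ ξ`. -/
def shift (h : H) (ξ : ∀ n, HilbertPow H n) : ∀ n, HilbertPow H n
  | 0 => 0
  | n + 1 => tens h (ξ n)

theorem hasSum_norm_sq_shift (h : H) (ξ : FullFock H) :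
    HasSum (fun n => ‖shift h ξ n‖ ^ (2 : ℕ)) (‖h‖ ^ 2 * ‖ξ‖ ^ 2) := by
  have h1 : HasSum (fun n => ‖ξ n‖ ^ (2 : ℕ)) (‖ξ‖ ^ 2) := by
    have := lp.hasSum_norm (p := 2) (by norm_num) ξ
    simpa using this
  have h2 : HasSum (fun n => ‖shift h ξ (n + 1)‖ ^ (2 : ℕ)) (‖h‖ ^ 2 * ‖ξ‖ ^ 2) := by
    have := h1.mul_left (‖h‖ ^ 2)
    simpa [shift, norm_tens, mul_pow] using this
  have h3 := (hasSum_nat_add_iff (f := fun n => ‖shift h ξ n‖ ^ (2 : ℕ)) 1).1 h2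
  simpa [shift] using h3

theorem memℓp_shift (h : H) (ξ : FullFock H) : Memℓp (shift h ξ) 2 :=
  memℓp_gen (by simpa using (hasSum_norm_sq_shift h ξ).summable)

/-- The creation operator: `Ω ↦ h`, `h₁ ⊗ ⋯ ⊗ hₙ ↦ h ⊗ h₁ ⊗ ⋯ ⊗ hₙ`. -/
def creation (h : H) : FullFock H →L[ℂ] FullFock H :=
  LinearMap.mkContinuous
    { toFun := fun ξ => (⟨shift h ξ, memℓp_shift h ξ⟩ : FullFock H)
      map_add' := fun ξ ζ => by
        apply lp.ext; funext n
        cases n with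
        | zero => change (0 : HilbertPow H 0) = 0 + 0; simp
        | succ n => exact tens_add h (ξ n) (ζ n)
      map_smul' := fun c ξ => by
        apply lp.ext; funext n
        cases n with
        | zero => change (0 : HilbertPow H 0) = c • 0; simp
        | succ n => exact tens_smul h c (ξ n) }
    ‖h‖ (fun ξ => by
      set ζ : FullFock H := ⟨shift h ξ, memℓp_shift h ξ⟩ with hζ
      have h1 : HasSum (fun n => ‖shift h ξ n‖ ^ (2 : ℕ)) (‖ζ‖ ^ 2) := by
        have := lp.hasSum_norm (p := 2) (by norm_num) ζ
        simpa using this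
      have h2 := h1.unique (hasSum_norm_sq_shift h ξ)
      rw [← mul_pow] at h2
      exact le_of_eq ((sq_eq_sq₀ (norm_nonneg _) (by positivity)).1 h2))

/-- The annihilation operator: `Ω ↦ 0`, `h₁ ⊗ ⋯ ⊗ hₙ ↦ ⟨h, h₁⟩ h₂ ⊗ ⋯ ⊗ hₙ`
(see `annihilation_vacuum` and `annihilation_single`), i.e. the adjoint of the creation
operator. -/
def annihilation (h : H) : FullFock H →L[ℂ] FullFock H :=
  ContinuousLinearMap.adjoint (creation h)

theorem creation_single (h : H) (n : ℕ) (y : HilbertPow H n) :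
    creation h (lp.single 2 n y) = lp.single 2 (n + 1) (tens h y) := by
  apply lp.ext; funext m
  cases m with
  | zero =>
    change (0 : HilbertPow H 0) = _
    rw [lp.single_apply_ne _ _ _ (by omega)]
  | succ m =>
    change tens h ((lp.single 2 n y : FullFock H) m) = _
    by_cases hm : m = n
    · subst hm; rw [lp.single_apply_self, lp.single_apply_self]
    · rw [lp.single_apply_ne _ _ _ hm, lp.single_apply_ne _ _ _ (by omega)]
      rw [← norm_eq_zero, norm_tens]; simp

theorem annihilation_vacuum (h : H) : annihilation h (vacuum : FullFock H) = 0 := by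
  refine ext_inner_right ℂ fun ξ => ?_
  rw [annihilation, ContinuousLinearMap.adjoint_inner_left, vacuum, lp.inner_single_left]
  change inner ℂ _ (0 : HilbertPow H 0) = _
  simp

theorem annihilation_single (h g : H) (n : ℕ) (y : HilbertPow H n) :
    annihilation h (lp.single 2 (n + 1) (tens g y) : FullFock H)
      = inner ℂ h g • lp.single 2 n y := by
  refine ext_inner_right ℂ fun ξ => ?_
  rw [annihilation, ContinuousLinearMap.adjoint_inner_left, lp.inner_single_left,
    inner_smul_left, lp.inner_single_left]
  change inner ℂ _ (tens h (ξ n)) = _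
  rw [inner_tens, inner_conj_symm]

end FullFock

/-! ## Nets over partitions -/

/-- The set of partitions `{R = t₁ < ⋯ < tₙ₊₁ = S}` of `[R, S]`, ordered by inclusion. -/
abbrev IntervalPartition (R S : ℝ) : Type :=
  {α : Finset ℝ // R ∈ α ∧ S ∈ α ∧ ∀ t ∈ α, R ≤ t ∧ t ≤ S}

/-- The ordered product `g t₁ t₂ * g t₂ t₃ * ⋯ * g tₙ tₙ₊₁` along a partition. -/
def IntervalPartition.prod {M : Type*} [Monoid M] {R S : ℝ} (α : IntervalPartition R S)
    (g : ℝ → ℝ → M) : M :=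
  (List.zipWith g (α.1.sort (· ≤ ·)) (α.1.sort (· ≤ ·)).tail).prod

/-! ## The process -/

/-- `L²(ℝ₊, D)`, for the completion of the pre-Hilbert space `D`. -/
abbrev OneParticle (D : Type*) [NormedAddCommGroup D] [InnerProductSpace ℂ D] :=
  Lp (Completion D) 2 (volume.restrict (Set.Ici (0 : ℝ)))

/-- The full Fock space over `L²(ℝ₊, D)`. -/
abbrev FockL2 (D : Type*) [NormedAddCommGroup D] [InnerProductSpace ℂ D] :=
  FullFock (OneParticle D)

/-- Bounded operators on the full Fock space over `L²(ℝ₊, D)`. -/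
abbrev FockOp (D : Type*) [NormedAddCommGroup D] [InnerProductSpace ℂ D] :=
  FockL2 D →L[ℂ] FockL2 D

/-- `χ_{[r,s]} ⊗ v ∈ L²(ℝ₊, D)`. -/
def chiTensor {D : Type*} [NormedAddCommGroup D] [InnerProductSpace ℂ D]
    (r s : ℝ) (v : D) : OneParticle D :=
  indicatorConstLp 2 (measurableSet_Icc (a := r) (b := s))
    (ne_top_of_le_ne_top (measure_Icc_lt_top (μ := volume)).ne
      (Measure.restrict_apply_le _ _)) (v : Completion D)

variable {d : ℕ} {D : Type*} [NormedAddCommGroup D] [InnerProductSpace ℂ D]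

/-- The matrix `g_{r,s}` with entries
`δ_{kl} id + A^*(χ_{[r,s]} ⊗ η(x_{kl})) + A(χ_{[r,s]} ⊗ η(x_{kl}^*)) + (s - r) Ψ(x_{kl}) id`. -/
def whiteNoiseMatrix (T : SchurmannTriple d D) (r s : ℝ) :
    Matrix (Fin d) (Fin d) (FockOp D) := Matrix.of fun k l =>
  (if k = l then 1 else 0)
    + FullFock.creation (chiTensor r s (T.η (KD.x k l)))
    + FullFock.annihilation (chiTensor r s (T.η (star (KD.x k l))))
    + (((s - r : ℝ) : ℂ) * T.Ψ (KD.x k l)) • 1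

/-- `Θ_α = g_{t₁,t₂} ⋯ g_{tₙ,tₙ₊₁}`. -/
def Theta (T : SchurmannTriple d D) {R S : ℝ} (α : IntervalPartition R S) :
    Matrix (Fin d) (Fin d) (FockOp D) :=
  α.prod (whiteNoiseMatrix T)

/-- A family of unital `*`-homomorphisms `f_{r,s} : K⟨d⟩ → B(Γ)`, indexed by `0 ≤ r ≤ s`. -/
abbrev OpFamily (d : ℕ) (D : Type*) [NormedAddCommGroup D] [InnerProductSpace ℂ D] :=
  ∀ r s : ℝ, 0 ≤ r → r ≤ s → (KD d →⋆ₐ[ℂ] FockOp D)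

/-- `f` is the process of the triple: for `r < s` the matrix `(f_{r,s}(x_{kl}))` is the limit
`U_{r,s}` (entrywise, in operator norm) of the net `Θ_α` over the partitions of `[r, s]`, and
`f_{r,r} = δ(·) id`. -/
structure IsFockProcess (T : SchurmannTriple d D) (f : OpFamily d D) : Prop where
  tendsto : ∀ (r s : ℝ) (hr : 0 ≤ r) (hrs : r < s) (k l : Fin d),
    Tendsto (fun α : IntervalPartition r s => Theta T α k l) atTop
      (𝓝 (f r s hr hrs.le (KD.x k l)))
  diag : ∀ (r : ℝ) (hr : 0 ≤ r) (b : KD d), f r r hr le_rfl b = KD.counit b • 1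

/-- The unital `*`-subalgebra generated by all `f_{r,s}(b)`. -/
def generatedSubalgebra (f : OpFamily d D) : StarSubalgebra ℂ (FockOp D) :=
  StarAlgebra.adjoin ℂ {a | ∃ (r s : ℝ) (hr : 0 ≤ r) (hrs : r ≤ s) (b : KD d),
    a = f r s hr hrs b}

/-- `f` is cyclic: the generated algebra applied to the vacuum is dense. -/
def IsCyclicFamily (f : OpFamily d D) : Prop :=
  Dense {ξ : FockL2 D | ∃ a ∈ generatedSubalgebra f, ξ = a FullFock.vacuum}

end

/-! Work in the C*-algebra of d×d matrices over B(Γ). Because ρ is trivial on the generators,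
η(x_kl^*) = -η(x_lk), so the increment over an interval of length h is g = 1 + hψ - B^* + B, with B
the matrix of creators of that interval and ψ = (Ψ(x_kl)). Two relations carry everything: B_I^* s
B_J = 0 for successive intervals I, J and scalar matrices s, and B^*B + h(ψ + ψ^*) = 0, which is
X^*X = E read through Ψ. `FreeNoise` isolates them.

Since ‖B‖ is only O(√h), multiplying the norms of the factors gives no bound. But creation parts of
successive intervals are orthogonal, so the squares of their norms add; `energy_step` turns this
into a Gronwall estimate.

Convergence: B^* kills whatever begins with a later creator, so the product is W + S(W), with W the
part without the factors B (`W_add_S`). The adjoint of W, read backwards in time, is the drift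
product plus its own creation recursion (`star_W`). Thus the recursion `S`, applied twice to the
drift product, yields the full product, and it preserves an O(√μ) bound for refinements of a path of
mesh μ (`RegularBound.add_S`). The net is therefore Cauchy.

Unitarity: the second relation cancels the first-order scalar part of gg^* - 1, leaving a creation
part, its adjoint and a remainder O(h^{3/2}). The energy estimate makes the accumulated error O(√μ);
time reversal gives the other product.

Cyclicity: on a short interval U - g is a creation part plus an annihilation part of norm O(h), plus
O(h²). Summed over a fine path, the first two are small by orthogonality, the last trivially, so g -
1 is a norm limit of sums of U - 1 (`g_sub_one_mem`). Hence the field operators lie in the closed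
algebra of the process. Removing annihilators degree by degree then builds the Fock space from Ω,
the vectors χ ⊗ η(x_kl) being total (`eq_top_of_field_mem`). -/

noncomputable section

variable {d : ℕ} {D : Type*} [NormedAddCommGroup D] [InnerProductSpace ℂ D]

/-! ## Paths and refinements -/

/-- The ordered product of `g` over consecutive entries of a list. -/
def pathProd {M : Type*} [Monoid M] (g : ℝ → ℝ → M) (l : List ℝ) : M :=
  (List.zipWith g l l.tail).prod

@[simp] theorem pathProd_singleton {M : Type*} [Monoid M] (g : ℝ → ℝ → M) (a : ℝ) :
    pathProd g [a] = 1 := by simp [pathProd]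

@[simp] theorem pathProd_cons_cons {M : Type*} [Monoid M] (g : ℝ → ℝ → M) (a b : ℝ)
    (l : List ℝ) : pathProd g (a :: b :: l) = g a b * pathProd g (b :: l) := by
  simp [pathProd]

/-- `l` increases strictly from `a` to `T` with steps at most `μ`. -/
inductive IsPath (μ : ℝ) : ℝ → ℝ → List ℝ → Prop
  | nil (a : ℝ) : IsPath μ a a [a]
  | cons {a b T : ℝ} {l : List ℝ} : a < b → b - a ≤ μ → IsPath μ b T (b :: l) →
      IsPath μ a T (a :: b :: l)

/-- The path `β` from `a` to `T` refines the path `α`, whose steps are at most `μ`. -/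
inductive Refines (μ : ℝ) : ℝ → ℝ → List ℝ → List ℝ → Prop
  | nil (a : ℝ) : Refines μ a a [a] [a]
  | keep {a b T : ℝ} {l l' : List ℝ} : a < b → b - a ≤ μ → Refines μ b T (b :: l) (b :: l') →
      Refines μ a T (a :: b :: l) (a :: b :: l')
  -- Here β stops at b inside the coarse step from a to e. The coarse path is restarted at b, so
  -- both paths keep a common starting point and one step of β is treated at a time.
  | skip {a b e T : ℝ} {l l' : List ℝ} : a < b → b < e → e - a ≤ μ →
      Refines μ b T (b :: l) (b :: e :: l') → Refines μ a T (a :: b :: l) (a :: e :: l')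

theorem IsPath.le {μ a T : ℝ} {l : List ℝ} (h : IsPath μ a T l) : a ≤ T := by
  induction h with
  | nil => exact le_rfl
  | cons h1 _ _ ih => exact h1.le.trans ih

theorem Refines.left {μ a T : ℝ} {β α : List ℝ} (h : Refines μ a T β α) : IsPath μ a T β := by
  induction h with
  | nil => exact .nil _
  | keep h1 h2 _ ih => exact .cons h1 h2 ih
  | skip h1 h2 h3 _ ih => exact .cons h1 (by linarith) ih

theorem Refines.right {μ a T : ℝ} {β α : List ℝ} (h : Refines μ a T β α) : IsPath μ a T α := by
  induction h with
  | nil => exact .nil _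
  | keep h1 h2 _ ih => exact .cons h1 h2 ih
  | skip h1 h2 h3 _ ih =>
    cases ih with
    | cons h4 h5 h6 => exact .cons (h1.trans h2) h3 h6

theorem isPath_iff {μ a T : ℝ} {l : List ℝ} : IsPath μ a T l ↔
    l.IsChain (fun x y => x < y ∧ y - x ≤ μ) ∧ l.head? = some a ∧ l.getLast? = some T := by
  constructor
  · intro h
    induction h with
    | nil => simp
    | cons h1 h2 _ ih =>
      refine ⟨List.isChain_cons_cons.2 ⟨⟨h1, h2⟩, ih.1⟩, rfl, ?_⟩
      rw [List.getLast?_cons_cons]; exact ih.2.2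
  · rintro ⟨h1, h2, h3⟩
    induction l generalizing a with
    | nil => simp at h2
    | cons x l ih =>
      obtain rfl : x = a := by simpa using h2
      cases l with
      | nil =>
        obtain rfl : x = T := by simpa using h3
        exact .nil _
      | cons y l =>
        rw [List.isChain_cons_cons] at h1
        rw [List.getLast?_cons_cons] at h3
        exact .cons h1.1.1 h1.1.2 (ih h1.2 rfl h3)

theorem IsPath.pairwise {μ a T : ℝ} {l : List ℝ} (h : IsPath μ a T l) : l.Pairwise (· < ·) :=
  List.isChain_iff_pairwise.1 ((isPath_iff.1 h).1.imp fun _ _ h => h.1)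

theorem IsPath.head_eq {μ a x T : ℝ} {l : List ℝ} (h : IsPath μ a T (x :: l)) : x = a := by
  simpa using (isPath_iff.1 h).2.1

theorem Refines.sublist {μ a T : ℝ} {β α : List ℝ} (h : Refines μ a T β α) : α.Sublist β := by
  induction h with
  | nil => exact List.Sublist.refl _
  | keep h1 h2 _ ih => exact ih.cons_cons _
  | skip h1 h2 h3 _ ih =>
    exact List.Sublist.cons_cons _ ((List.sublist_cons_self _ _).trans ih)

/-- The mesh ν of the fine path is irrelevant: its steps lie inside those of the coarse one. -/
theorem Refines.of_sublist {μ ν a T : ℝ} {β α : List ℝ} (hβ : IsPath ν a T β)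
    (hα : IsPath μ a T α) (h : α.Sublist β) : Refines μ a T β α := by
  induction hβ generalizing α with
  | nil a =>
    cases hα with
    | nil => exact .nil _
    | cons h1 h2 h3 => exact absurd h3.le (not_le.2 h1)
  | @cons a b T l h1 h2 h3 ih =>
    cases hα with
    | nil => exact absurd h3.le (not_le.2 h1)
    | @cons _ e _ l' h4 h5 h6 =>
      have hs : (e :: l').Sublist (b :: l) := by simpa using h
      have hbe : b ≤ e := by
        have : e ∈ b :: l := hs.subset (by simp)
        rcases List.mem_cons.1 this with rfl | hm
        · exact le_rfl
        · exact (List.rel_of_pairwise_cons h3.pairwise hm).le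
      rcases hbe.eq_or_lt with rfl | hlt
      · exact .keep h4 h5 (ih h6 hs)
      · refine .skip h1 hlt h5 (ih (.cons hlt (by linarith) h6) ?_)
        refine List.Sublist.cons_cons _ ?_
        cases hs with
        | cons _ h => exact h
        | cons_cons _ h => exact absurd hlt (lt_irrefl _)

/-- Time reversal of a path. -/
def negRev (l : List ℝ) : List ℝ := (l.map Neg.neg).reverse

theorem IsPath.negRev {μ a T : ℝ} {l : List ℝ} (h : IsPath μ a T l) :
    IsPath μ (-T) (-a) (negRev l) := by
  rw [isPath_iff] at h ⊢
  obtain ⟨h1, h2, h3⟩ := h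
  refine ⟨?_, ?_, ?_⟩
  · rw [_root_.negRev, List.isChain_reverse, List.isChain_map]
    exact h1.imp fun x y h => ⟨neg_lt_neg h.1, by linarith [h.2]⟩
  · simp [_root_.negRev, h3]
  · simp [_root_.negRev, h2]

theorem Refines.negRev {μ a T : ℝ} {β α : List ℝ} (h : Refines μ a T β α) :
    Refines μ (-T) (-a) (negRev β) (negRev α) :=
  .of_sublist h.left.negRev h.right.negRev (h.sublist.map _).reverse

theorem pathProd_append {M : Type*} [Monoid M] (g : ℝ → ℝ → M) (l : List ℝ) (x y : ℝ) :
    pathProd g (l ++ [x, y]) = pathProd g (l ++ [x]) * g x y := by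
  induction l with
  | nil => simp
  | cons a l ih =>
    cases l with
    | nil => simp
    | cons b l => simp only [List.cons_append, pathProd_cons_cons] at ih ⊢; rw [ih, mul_assoc]

/-- The adjoint reverses the factors, and negating the times makes the list increase again.
Estimates for creation parts pass to annihilation parts in this way. -/
theorem star_pathProd {M : Type*} [Monoid M] [StarMul M] (g : ℝ → ℝ → M) (l : List ℝ) :
    star (pathProd g l) = pathProd (fun a b => star (g (-b) (-a))) (negRev l) := by
  induction l with
  | nil => simp [pathProd, negRev]
  | cons a l ih =>
    cases l with
    | nil => simp [negRev]
    | cons b l =>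
      rw [pathProd_cons_cons, star_mul, ih]
      simp only [negRev, List.map_cons, List.reverse_cons, List.append_assoc, List.cons_append,
        List.nil_append]
      rw [pathProd_append]; simp

/-! ## Free noises -/

/-- An operator-valued creation noise `B` with drift `ψ`, over an algebra of scalars, such that
annihilators of one interval kill creators of a disjoint one. -/
structure FreeNoise (𝓐 : Type*) [CStarAlgebra 𝓐] where
  scalars : StarSubalgebra ℂ 𝓐
  B : ℝ → ℝ → 𝓐
  ψ : 𝓐
  K : ℝ
  dom : Set ℝ
  ψ_mem : ψ ∈ scalars
  B_add : ∀ {a b c : ℝ}, a ≤ b → b ≤ c → B a c = B a b + B b c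
  orth : ∀ {a b c e : ℝ}, a ≤ b → b ≤ c → c ≤ e → ∀ s ∈ scalars, star (B a b) * s * B c e = 0
  one_le_K : 1 ≤ K
  norm_B_sq : ∀ {a b : ℝ}, a ≤ b → ‖B a b‖ ^ 2 ≤ K * (b - a)
  norm_ψ : ‖ψ‖ ≤ K
  unit : ∀ {a b : ℝ}, a ∈ dom → b ∈ dom → a ≤ b →
    star (B a b) * B a b + ((b - a : ℝ) : ℂ) • (ψ + star ψ) = 0

namespace FreeNoise

variable {𝓐 : Type*} [CStarAlgebra 𝓐] (N : FreeNoise 𝓐)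

theorem orth' {a b c e : ℝ} (h1 : a ≤ b) (h2 : b ≤ c) (h3 : c ≤ e) {s : 𝓐} (hs : s ∈ N.scalars) :
    star (N.B c e) * s * N.B a b = 0 := by
  have := congrArg star (N.orth h1 h2 h3 (star s) (star_mem hs))
  simpa [mul_assoc] using this

/-- The time-reversed adjoint noise. -/
def rev : FreeNoise 𝓐 where
  scalars := N.scalars
  B a b := -N.B (-b) (-a)
  ψ := star N.ψ
  K := N.K
  dom := {t | -t ∈ N.dom}
  ψ_mem := star_mem N.ψ_mem
  B_add {a b c} h1 h2 := by
    rw [N.B_add (neg_le_neg h2) (neg_le_neg h1)]; abel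
  orth {a b c e} h1 h2 h3 s hs := by
    simpa using N.orth' (neg_le_neg h3) (neg_le_neg h2) (neg_le_neg h1) hs
  one_le_K := N.one_le_K
  norm_B_sq {a b} h := by
    rw [norm_neg]; refine (N.norm_B_sq (neg_le_neg h)).trans_eq ?_; ring
  norm_ψ := by rw [norm_star]; exact N.norm_ψ
  -- The relation is symmetric in ψ and its adjoint, and the sign of B cancels.
  unit {a b} ha hb h := by
    have := N.unit hb ha (neg_le_neg h)
    rw [star_star, star_neg, neg_mul_neg, add_comm (star N.ψ)]
    rw [← this, show -a - -b = b - a by ring]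

/-- The drift factor `1 + (b - a) ψ`. -/
def t (a b : ℝ) : 𝓐 := 1 + ((b - a : ℝ) : ℂ) • N.ψ

/-- The increment `1 + B - B^* + (b - a) ψ`. -/
def g (a b : ℝ) : 𝓐 := N.t a b - star (N.B a b) + N.B a b

theorem t_mem (a b : ℝ) : N.t a b ∈ N.scalars :=
  add_mem (one_mem _) (N.scalars.smul_mem N.ψ_mem _)

theorem star_g (a b : ℝ) : star (N.g a b) = N.rev.g (-b) (-a) := by
  simp only [g, t, rev, star_add, star_sub, star_one, star_smul, star_star, star_neg, neg_neg,
    RCLike.star_def, Complex.conj_ofReal]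
  rw [show -a - -b = b - a by ring]; abel

/-- Only an inequality, because the algebra may be zero (matrices of size d = 0). -/
theorem norm_one_le : ‖(1 : 𝓐)‖ ≤ 1 := by
  nontriviality 𝓐
  exact CStarRing.norm_one.le

theorem norm_ofReal_smul {h : ℝ} (hh : 0 ≤ h) (x : 𝓐) : ‖(h : ℂ) • x‖ = h * ‖x‖ := by
  rw [norm_smul, Complex.norm_real, Real.norm_of_nonneg hh]

theorem norm_t_le {a b : ℝ} (h : a ≤ b) : ‖N.t a b‖ ≤ 1 + N.K * (b - a) := by
  refine (norm_add_le _ _).trans (add_le_add norm_one_le ?_)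
  rw [norm_ofReal_smul (sub_nonneg.2 h), mul_comm]
  exact mul_le_mul_of_nonneg_right N.norm_ψ (sub_nonneg.2 h)

theorem K_pos : 0 < N.K := zero_lt_one.trans_le N.one_le_K

theorem norm_B_le {a b : ℝ} (h : a ≤ b) : ‖N.B a b‖ ≤ N.K * √(b - a) := by
  have h1 := N.norm_B_sq h
  have h2 := N.one_le_K
  have h3 : 0 ≤ b - a := sub_nonneg.2 h
  refine abs_le_of_sq_le_sq' ?_ (by positivity) |>.2
  rw [mul_pow, Real.sq_sqrt h3]
  -- K ≤ K² because K ≥ 1.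
  nlinarith [mul_nonneg (mul_nonneg N.K_pos.le h3) (sub_nonneg.2 h2)]

/-- `D` belongs to the right ideal (in the sense of double annihilators) generated by the
creators of subintervals of `[a, b]`. -/
def Lives (a b : ℝ) (D : 𝓐) : Prop :=
  ∀ R : 𝓐, (∀ c e : ℝ, a ≤ c → c ≤ e → e ≤ b → ∀ s ∈ N.scalars, R * s * N.B c e = 0) → R * D = 0

variable {N}

/-! ### Orthogonality of creation parts -/

theorem lives_B {a b : ℝ} (h : a ≤ b) : N.Lives a b (N.B a b) := fun R hR => by
  simpa using hR a b le_rfl h le_rfl 1 (one_mem _)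

theorem lives_zero (a b : ℝ) : N.Lives a b 0 := fun R _ => mul_zero R

theorem Lives.add {a b : ℝ} {D E : 𝓐} (hD : N.Lives a b D) (hE : N.Lives a b E) :
    N.Lives a b (D + E) := fun R hR => by rw [mul_add, hD R hR, hE R hR, add_zero]

theorem Lives.sub {a b : ℝ} {D E : 𝓐} (hD : N.Lives a b D) (hE : N.Lives a b E) :
    N.Lives a b (D - E) := fun R hR => by rw [mul_sub, hD R hR, hE R hR, sub_zero]

theorem Lives.smul {a b : ℝ} {D : 𝓐} (hD : N.Lives a b D) (c : ℂ) :
    N.Lives a b (c • D) := fun R hR => by rw [mul_smul_comm, hD R hR, smul_zero]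

theorem Lives.mul {a b : ℝ} {D : 𝓐} (hD : N.Lives a b D) (x : 𝓐) : N.Lives a b (D * x) :=
  fun R hR => by rw [← mul_assoc, hD R hR, zero_mul]

/-- The scalar between R and the creator in `Lives` is there to absorb s, so that drift factors may
stand to the left of creators. -/
theorem Lives.scalar_mul {a b : ℝ} {D s : 𝓐} (hD : N.Lives a b D) (hs : s ∈ N.scalars) :
    N.Lives a b (s * D) := fun R hR => by
  rw [← mul_assoc]
  refine hD _ fun c e h1 h2 h3 s' hs' => ?_
  rw [mul_assoc R]
  exact hR c e h1 h2 h3 _ (mul_mem hs hs')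

theorem Lives.mono {a b a' b' : ℝ} {D : 𝓐} (hD : N.Lives a b D) (ha : a' ≤ a) (hb : b ≤ b') :
    N.Lives a' b' D := fun R hR =>
  hD R fun c e h1 h2 h3 => hR c e (ha.trans h1) h2 (h3.trans hb)

/-- The annihilator definition is used twice: first for E, with R = D^* s, and then, after taking
adjoints, for D, which reduces the claim to orthogonality of elementary creators. -/
theorem Lives.orth {a b c e : ℝ} {D E s : 𝓐} (hD : N.Lives a b D) (hE : N.Lives c e E)
    (hbc : b ≤ c) (hs : s ∈ N.scalars) : star D * s * E = 0 := by
  refine hE _ fun c' e' h1 h2 h3 s' hs' => ?_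
  have : star (N.B c' e') * star (s * s') * D = 0 := hD _ fun a' b' h4 h5 h6 s'' hs'' => by
    rw [mul_assoc (star _)]
    exact N.orth' h5 (h6.trans (hbc.trans h1)) h2 (mul_mem (star_mem (mul_mem hs hs')) hs'')
  simpa [mul_assoc] using congrArg star this

theorem Lives.star_mul_eq_zero {a b c e : ℝ} {D E : 𝓐} (hD : N.Lives a b D) (hE : N.Lives c e E)
    (hbc : b ≤ c) : star D * E = 0 := by
  simpa using hD.orth hE hbc (one_mem _)

/-- Pythagoras in a C*-algebra: the cross terms of (D + E)^*(D + E) vanish. -/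
theorem norm_sq_add_le {D E : 𝓐} (h : star D * E = 0) : ‖D + E‖ ^ 2 ≤ ‖D‖ ^ 2 + ‖E‖ ^ 2 := by
  have h' : star E * D = 0 := by simpa using congrArg star h
  rw [sq, ← CStarRing.norm_star_mul_self, star_add, add_mul, mul_add, mul_add, h, h', add_zero,
    zero_add, sq, sq, ← CStarRing.norm_star_mul_self, ← CStarRing.norm_star_mul_self]
  exact norm_add_le _ _

end FreeNoise

/-! ## The energy inequality -/

/-- The growth rate in the energy inequality. -/
def energyRate (K L : ℝ) : ℝ :=
  (2 * K + K ^ 2 * L) + (1 + K * L) + L + 2 * K ^ 3 + 2 * K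

theorem energyRate_nonneg {K L : ℝ} (hK : 0 ≤ K) (hL : 0 ≤ L) : 0 ≤ energyRate K L := by
  unfold energyRate; positivity

/-- The left side is x² + ε² plus terms carrying a factor h; one factor h is kept, any further one
is bounded by L, and 1 + ch ≤ exp(ch) finishes. -/
theorem energy_numeric {K L h x ε : ℝ} (hK : 1 ≤ K) (hh : 0 ≤ h) (hL : h ≤ L) :
    ((1 + K * h) * x + h * ε) ^ 2 + K * h * (K * x + ε) ^ 2 + ε ^ 2
      ≤ Real.exp (energyRate K L * h) * (x ^ 2 + ε ^ 2) := by
  have hK0 : 0 ≤ K := zero_le_one.trans hK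
  refine le_trans ?_ (mul_le_mul_of_nonneg_right (Real.add_one_le_exp _) (by positivity))
  have h1 : 2 * x * ε ≤ x ^ 2 + ε ^ 2 := by nlinarith [sq_nonneg (x - ε)]
  have h2 : (K * x + ε) ^ 2 ≤ 2 * K ^ 2 * x ^ 2 + 2 * ε ^ 2 := by nlinarith [sq_nonneg (K * x - ε)]
  have h3 : K * h * (K * x + ε) ^ 2 ≤ K * h * (2 * K ^ 2 * x ^ 2 + 2 * ε ^ 2) :=
    mul_le_mul_of_nonneg_left h2 (by positivity)
  have h4 : (1 + K * h) * h * (2 * x * ε) ≤ (1 + K * h) * h * (x ^ 2 + ε ^ 2) :=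
    mul_le_mul_of_nonneg_left h1 (by positivity)
  have h5 : (L - h) * (K * h * (x ^ 2 + ε ^ 2) + K ^ 2 * h * x ^ 2 + h * ε ^ 2) ≥ 0 := by
    have := sub_nonneg.2 hL
    positivity
  have h6 : 0 ≤ h * ((2 * K + K ^ 2 * L + 2 * K ^ 3) * ε ^ 2 + (L + 2 * K) * x ^ 2) := by
    have := hh.trans hL
    positivity
  unfold energyRate
  nlinarith [h3, h4, h5, h6]

namespace FreeNoise

variable {𝓐 : Type*} [CStarAlgebra 𝓐] {N : FreeNoise 𝓐}

/-- The Gronwall step. E and B y are orthogonal, so the creator contributes ‖B‖²‖y‖² = O(h) instead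
of O(√h). Carrying ε² on both sides makes the estimate multiplicative, hence iterable along a path.
-/
theorem energy_step {a b K L x ε : ℝ} {E y : 𝓐} (hab : a ≤ b) (hL : b - a ≤ L) (hK : N.K ≤ K)
    (horth : star (N.B a b) * E = 0)
    (hE : ‖E‖ ≤ (1 + K * (b - a)) * x + (b - a) * ε) (hy : ‖y‖ ≤ K * x + ε) :
    ‖E + N.B a b * y‖ ^ 2 + ε ^ 2 ≤ Real.exp (energyRate K L * (b - a)) * (x ^ 2 + ε ^ 2) := by
  have h0 : 0 ≤ b - a := sub_nonneg.2 hab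
  have h1 : ‖E + N.B a b * y‖ ^ 2 ≤ ‖E‖ ^ 2 + ‖N.B a b * y‖ ^ 2 := by
    rw [add_comm, add_comm (‖E‖ ^ 2)]
    refine norm_sq_add_le ?_
    rw [star_mul, mul_assoc, horth, mul_zero]
  have h2 : ‖N.B a b * y‖ ^ 2 ≤ K * (b - a) * (K * x + ε) ^ 2 := by
    calc ‖N.B a b * y‖ ^ 2 ≤ (‖N.B a b‖ * ‖y‖) ^ 2 := by gcongr; exact norm_mul_le _ _
      _ = ‖N.B a b‖ ^ 2 * ‖y‖ ^ 2 := mul_pow _ _ _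
      _ ≤ K * (b - a) * (K * x + ε) ^ 2 := by
        refine mul_le_mul ((N.norm_B_sq hab).trans (by gcongr)) (by gcongr) (by positivity) ?_
        exact mul_nonneg (N.K_pos.le.trans hK) h0
  have h3 : ‖E‖ ^ 2 ≤ ((1 + K * (b - a)) * x + (b - a) * ε) ^ 2 := by gcongr
  have := energy_numeric (x := x) (ε := ε) (N.one_le_K.trans hK) h0 hL
  linarith

/-! ## The creation recursion -/

variable (N) in
/-- The creation recursion driven by `w`. -/
def S (w : List ℝ → 𝓐) : List ℝ → 𝓐
  -- Unfolded, this is the sum over the position of the first creator: drift factors before it, and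
  -- w + S w on the remaining path after it.
  | a :: b :: l => N.t a b * S w (b :: l) + N.B a b * (w (b :: l) + S w (b :: l))
  | _ => 0

theorem S_cons (w : List ℝ → 𝓐) (a b : ℝ) (l : List ℝ) : N.S w (a :: b :: l)
    = N.t a b * N.S w (b :: l) + N.B a b * (w (b :: l) + N.S w (b :: l)) := by rw [S]

theorem S_singleton (w : List ℝ → 𝓐) (a : ℝ) : N.S w [a] = 0 := by simp [S]

theorem S_lives (w : List ℝ → 𝓐) {μ a T : ℝ} {l : List ℝ} (h : IsPath μ a T l) :
    N.Lives a T (N.S w l) := by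
  induction h with
  | nil => rw [S_singleton]; exact lives_zero _ _
  | cons h1 h2 h3 ih =>
    rw [S_cons]
    exact ((ih.scalar_mul (N.t_mem _ _)).mono h1.le le_rfl).add
      (((lives_B h1.le).mul _).mono le_rfl h3.le)

/-- Boundedness, small increments and stability under refinement for functionals of paths. -/
structure RegularBound (w : List ℝ → 𝓐) (L M : ℝ) : Prop where
  nonneg : 0 ≤ M
  bound : ∀ {μ a T : ℝ} {l : List ℝ}, IsPath μ a T l → T - a ≤ L → ‖w l‖ ≤ M
  incr : ∀ {μ a b T : ℝ} {l : List ℝ}, a < b → IsPath μ b T (b :: l) → T - a ≤ L →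
    ‖w (a :: b :: l) - w (b :: l)‖ ≤ M * √(b - a)
  refine : ∀ {μ a T : ℝ} {β α : List ℝ}, 0 ≤ μ → μ ≤ 1 → Refines μ a T β α → T - a ≤ L →
    ‖w β - w α‖ ≤ M * √μ

theorem norm_le_of_sq_add_le {x ε c : ℝ} (hε : 0 ≤ ε) (h : x ^ 2 + ε ^ 2 ≤ Real.exp c * ε ^ 2) :
    x ≤ Real.exp c * ε := by
  rcases le_total c 0 with hc | hc
  · have : Real.exp c * ε ^ 2 ≤ 1 * ε ^ 2 := by gcongr; exact Real.exp_le_one_iff.2 hc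
    have hx : x = 0 := by nlinarith [sq_nonneg x]
    rw [hx]; positivity
  · have h1 : 1 ≤ Real.exp c := Real.one_le_exp hc
    refine abs_le_of_sq_le_sq' ?_ (by positivity) |>.2
    have : Real.exp c * ε ^ 2 ≤ Real.exp c * (Real.exp c * ε ^ 2) := le_mul_of_one_le_left (by positivity) h1
    nlinarith [sq_nonneg ε]

/-- Gronwall with ε = M, the drift term as the orthogonal part E and w + S w as the vector hit by
the creator. -/
theorem norm_S_le {w : List ℝ → 𝓐} {L M : ℝ} (hM : 0 ≤ M)
    (hw : ∀ {μ a T : ℝ} {l : List ℝ}, IsPath μ a T l → T - a ≤ L → ‖w l‖ ≤ M)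
    {μ a T : ℝ} {l : List ℝ} (h : IsPath μ a T l) (hL : T - a ≤ L) :
    ‖N.S w l‖ ≤ Real.exp (energyRate N.K L * L) * M := by
  have hT := h.le
  have key : ‖N.S w l‖ ^ 2 + M ^ 2 ≤ Real.exp (energyRate N.K L * (T - a)) * M ^ 2 := by
    induction h with
    | nil => simp [S_singleton]
    | @cons a b T l h1 h2 h3 ih =>
      have hbT := h3.le
      have ih := ih (by linarith) hbT
      rw [S_cons]
      refine (energy_step (L := L) (x := ‖N.S w (b :: l)‖) h1.le (by linarith) le_rfl ?_
        ?_ ?_).trans ?_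
      · exact (lives_B h1.le).star_mul_eq_zero ((S_lives w h3).scalar_mul (N.t_mem _ _)) le_rfl
      · refine ((norm_mul_le _ _).trans
          (mul_le_mul_of_nonneg_right (N.norm_t_le h1.le) (norm_nonneg _))).trans ?_
        exact le_add_of_nonneg_right (mul_nonneg (sub_nonneg.2 h1.le) hM)
      · refine (norm_add_le _ _).trans ?_
        rw [add_comm]
        exact add_le_add (le_mul_of_one_le_left (norm_nonneg _) N.one_le_K)
          (hw h3 (by linarith))
      · calc _ ≤ Real.exp (energyRate N.K L * (b - a)) *
              (Real.exp (energyRate N.K L * (T - b)) * M ^ 2) := by gcongr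
          _ = _ := by rw [← mul_assoc, ← Real.exp_add]; ring_nf
  refine norm_le_of_sq_add_le hM (key.trans ?_)
  have := energyRate_nonneg N.K_pos.le ((sub_nonneg.2 hT).trans hL)
  gcongr

theorem le_mul_sqrt {h L : ℝ} (hL : 1 ≤ L) (hh : 0 ≤ h) (h' : h ≤ L) : h ≤ L * √h := by
  have h1 : √h ≤ L := Real.sqrt_le_iff.2 ⟨by linarith, by nlinarith⟩
  nlinarith [Real.mul_self_sqrt hh, Real.sqrt_nonneg h]

theorem norm_S_incr_le {w : List ℝ → 𝓐} {L M M' : ℝ} (hL : 1 ≤ L) {a b : ℝ} {l : List ℝ}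
    (hab : a < b) (hbL : b - a ≤ L) (hw : ‖w (b :: l)‖ ≤ M) (hS : ‖N.S w (b :: l)‖ ≤ M') :
    ‖N.S w (a :: b :: l) - N.S w (b :: l)‖ ≤ (L * N.K * M' + N.K * (M + M')) * √(b - a) := by
  have h0 : 0 ≤ b - a := sub_nonneg.2 hab.le
  have hK := N.K_pos
  have hM' : 0 ≤ M' := (norm_nonneg _).trans hS
  have e : N.S w (a :: b :: l) - N.S w (b :: l) = ((b - a : ℝ) : ℂ) • (N.ψ * N.S w (b :: l))
      + N.B a b * (w (b :: l) + N.S w (b :: l)) := by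
    rw [S_cons, t, add_mul, one_mul, smul_mul_assoc]; abel
  rw [e, add_mul]
  refine (norm_add_le _ _).trans (add_le_add ?_ ?_)
  · rw [norm_ofReal_smul h0]
    calc (b - a) * ‖N.ψ * N.S w (b :: l)‖ ≤ (L * √(b - a)) * (N.K * M') := by
          refine mul_le_mul (le_mul_sqrt hL h0 hbL) ((norm_mul_le _ _).trans ?_)
            (norm_nonneg _) (by positivity)
          exact mul_le_mul N.norm_ψ hS (norm_nonneg _) hK.le
      _ = _ := by ring
  · calc _ ≤ (N.K * √(b - a)) * (M + M') := by
          refine (norm_mul_le _ _).trans (mul_le_mul (N.norm_B_le hab.le)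
            ((norm_add_le _ _).trans (add_le_add hw hS)) (norm_nonneg _) (by positivity))
      _ = _ := by ring

/-- When [a, e] is cut at b, the coarse recursion still feeds the drift and the creator of [a, b]
with the path starting at e, not with the one starting at b. The mismatch consists of increments of
S and w over [b, e]. -/
theorem S_refine_skip (w : List ℝ → 𝓐) {a b e : ℝ} (hab : a ≤ b) (hbe : b ≤ e) (l l' : List ℝ) :
    N.S w (a :: b :: l) - N.S w (a :: e :: l')
      = (N.t a b * (N.S w (b :: l) - N.S w (b :: e :: l'))
        + ((b - a : ℝ) : ℂ) • (N.ψ * (N.S w (b :: e :: l') - N.S w (e :: l'))))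
        + N.B a b * ((w (b :: l) - w (b :: e :: l')) + (w (b :: e :: l') - w (e :: l'))
          + (N.S w (b :: e :: l') - N.S w (e :: l')) + (N.S w (b :: l) - N.S w (b :: e :: l'))) := by
  rw [S_cons w a b, S_cons w a e, S_cons w b e, N.B_add hab hbe]
  simp only [t, add_mul, mul_add, mul_sub, one_mul, smul_mul_assoc, mul_smul_comm,
    smul_add, smul_sub, smul_smul]
  push_cast
  module

/-- The energy estimate for the difference of two paths; inserting a point costs O(√μ) under the
creator and O(h√μ) in the drift. The factor T - a, which a plain O(√μ) bound would lose, is what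
`exists_decomposition` needs. -/
theorem S_refine {w : List ℝ → 𝓐} {L M : ℝ} (hL : 1 ≤ L) (hw : RegularBound w L M) :
    ∃ C, 0 ≤ C ∧ ∀ {μ a T : ℝ} {β α : List ℝ}, 0 ≤ μ → Refines μ a T β α → μ ≤ 1 → T - a ≤ L →
      N.Lives a T (N.S w β - N.S w α) ∧ ‖N.S w β - N.S w α‖ ^ 2 ≤ C * μ * (T - a) := by
  have hK := N.K_pos
  have hM := hw.nonneg
  set M' := Real.exp (energyRate N.K L * L) * M with hM'
  have hM'0 : 0 ≤ M' := by positivity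
  have hS : ∀ {μ a T : ℝ} {l : List ℝ}, IsPath μ a T l → T - a ≤ L → ‖N.S w l‖ ≤ M' :=
    norm_S_le hM hw.bound
  set I := L * N.K * M' + N.K * (M + M') with hI
  have hI0 : 0 ≤ I := by positivity
  set G := energyRate N.K L
  have hG : 0 ≤ G := energyRate_nonneg hK.le (zero_le_one.trans hL)
  refine ⟨(2 * M + I + N.K * I) ^ 2 * (G * Real.exp (G * L)), by positivity, ?_⟩
  intro μ a T β α hμ h hμ1 hTL
  refine ⟨(S_lives w h.left).sub (S_lives w h.right), ?_⟩
  -- The errors under the creator are at most (2M + I)√μ: refinement of w, an increment of w, an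
  -- increment of S. The drift error is at most h·K·I√μ.
  set ε := (2 * M + I + N.K * I) * √μ with hε
  have hε0 : 0 ≤ ε := by positivity
  have hT := h.left.le
  have key : ‖N.S w β - N.S w α‖ ^ 2 + ε ^ 2 ≤ Real.exp (G * (T - a)) * ε ^ 2 := by
    induction h with
    | nil => simp [S_singleton]
    | @keep a b T l l' h1 h2 h3 ih =>
      have hbT := h3.left.le
      have ih := ih (by linarith) hbT
      have e : N.S w (a :: b :: l) - N.S w (a :: b :: l')
          = N.t a b * (N.S w (b :: l) - N.S w (b :: l')) + N.B a b * ((w (b :: l) - w (b :: l'))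
            + (N.S w (b :: l) - N.S w (b :: l'))) := by
        rw [S_cons, S_cons]; noncomm_ring
      rw [e]
      refine (energy_step (L := L) (K := N.K) (x := ‖N.S w (b :: l) - N.S w (b :: l')‖)
        h1.le (by linarith) le_rfl ?_ ?_ ?_).trans ?_
      · exact (lives_B h1.le).star_mul_eq_zero
          (((S_lives w h3.left).sub (S_lives w h3.right)).scalar_mul (N.t_mem _ _)) le_rfl
      · refine ((norm_mul_le _ _).trans
          (mul_le_mul_of_nonneg_right (N.norm_t_le h1.le) (norm_nonneg _))).trans ?_
        exact le_add_of_nonneg_right (mul_nonneg (sub_nonneg.2 h1.le) hε0)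
      · refine (norm_add_le _ _).trans ?_
        rw [add_comm]
        refine add_le_add (le_mul_of_one_le_left (norm_nonneg _) N.one_le_K)
          ((hw.refine hμ hμ1 h3 (by linarith)).trans ?_)
        rw [hε]; gcongr; nlinarith [mul_nonneg hK.le hI0]
      · calc _ ≤ Real.exp (G * (b - a)) * (Real.exp (G * (T - b)) * ε ^ 2) := by gcongr
          _ = _ := by rw [← mul_assoc, ← Real.exp_add]; ring_nf
    | @skip a b e T l l' h1 h2 h2' h3 ih =>
      have hbT := h3.left.le
      have ih := ih (by linarith) hbT
      have hp : IsPath μ b T (b :: e :: l') := h3.right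
      have hp' : IsPath μ e T (e :: l') := by cases hp with | cons _ _ h => exact h
      have heT := hp'.le
      have hsq : √(e - b) ≤ √μ := Real.sqrt_le_sqrt (by linarith)
      have hinc : ‖N.S w (b :: e :: l') - N.S w (e :: l')‖ ≤ I * √μ :=
        (norm_S_incr_le hL h2 (by linarith) (hw.bound hp' (by linarith))
          (hS hp' (by linarith))).trans (by gcongr)
      rw [S_refine_skip w h1.le h2.le]
      refine (energy_step (L := L) (K := N.K) (x := ‖N.S w (b :: l) - N.S w (b :: e :: l')‖)
        h1.le (by linarith) le_rfl ?_ ?_ ?_).trans ?_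
      · refine (lives_B h1.le).star_mul_eq_zero (Lives.add (a := b) (b := T) ?_ ?_) le_rfl
        · exact ((S_lives w h3.left).sub (S_lives w h3.right)).scalar_mul (N.t_mem _ _)
        · exact (((S_lives w hp).sub ((S_lives w hp').mono h2.le le_rfl)).scalar_mul
            N.ψ_mem).smul _
      · refine (norm_add_le _ _).trans (add_le_add ?_ ?_)
        · exact (norm_mul_le _ _).trans
            (mul_le_mul_of_nonneg_right (N.norm_t_le h1.le) (norm_nonneg _))
        · rw [norm_ofReal_smul (sub_nonneg.2 h1.le)]
          refine mul_le_mul_of_nonneg_left ((norm_mul_le _ _).trans ?_) (sub_nonneg.2 h1.le)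
          calc _ ≤ N.K * (I * √μ) := mul_le_mul N.norm_ψ hinc (norm_nonneg _) hK.le
            _ = (N.K * I) * √μ := by ring
            _ ≤ ε := by rw [hε]; gcongr; linarith
      · refine (norm_add_le _ _).trans ?_
        rw [add_comm]
        refine add_le_add (le_mul_of_one_le_left (norm_nonneg _) N.one_le_K) ?_
        calc _ ≤ M * √μ + M * √μ + I * √μ := by
              refine (norm_add_le _ _).trans (add_le_add ((norm_add_le _ _).trans
                (add_le_add (hw.refine hμ hμ1 h3 (by linarith)) ?_)) hinc)
              exact (hw.incr h2 hp' (by linarith)).trans (by gcongr)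
          _ = (2 * M + I) * √μ := by ring
          _ ≤ ε := mul_le_mul_of_nonneg_right (le_add_of_nonneg_right (mul_nonneg hK.le hI0))
            (Real.sqrt_nonneg _)
      · calc _ ≤ Real.exp (G * (b - a)) * (Real.exp (G * (T - b)) * ε ^ 2) := by gcongr
          _ = _ := by rw [← mul_assoc, ← Real.exp_add]; ring_nf
  -- For x ≥ 0, exp x - 1 ≤ x exp x; this extracts the factor T - a.
  have h1 : Real.exp (G * (T - a)) - 1 ≤ G * (T - a) * Real.exp (G * L) := by
    have h2 := Real.add_one_le_exp (-(G * (T - a)))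
    have h3 : Real.exp (G * (T - a)) ≤ Real.exp (G * L) := by gcongr
    have h4 : Real.exp (G * (T - a)) * Real.exp (-(G * (T - a))) = 1 := by
      rw [← Real.exp_add]; simp
    have h5 : 0 ≤ G * (T - a) := mul_nonneg hG (sub_nonneg.2 hT)
    nlinarith [Real.exp_pos (G * (T - a)), mul_le_mul_of_nonneg_left h3 h5,
      mul_le_mul_of_nonneg_left h2 (Real.exp_pos (G * (T - a))).le]
  have h2 : ε ^ 2 = (2 * M + I + N.K * I) ^ 2 * μ := by rw [hε, mul_pow, Real.sq_sqrt hμ]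
  calc _ ≤ ε ^ 2 * (Real.exp (G * (T - a)) - 1) := by linarith
    _ ≤ ε ^ 2 * (G * (T - a) * Real.exp (G * L)) := by gcongr
    _ = _ := by rw [h2]; ring

/-- The bootstrap: it passes from the drift product to the annihilation part, in reversed time, and
from there to the full product. -/
theorem RegularBound.add_S {w : List ℝ → 𝓐} {L M : ℝ} (hL : 1 ≤ L) (hw : RegularBound w L M) :
    ∃ M', RegularBound (fun l => w l + N.S w l) L M' := by
  obtain ⟨C, hC, h⟩ := S_refine (N := N) hL hw
  have hK := N.K_pos
  have hM := hw.nonneg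
  set M' := Real.exp (energyRate N.K L * L) * M with hM'
  have hM'0 : 0 ≤ M' := by positivity
  have hS : ∀ {μ a T : ℝ} {l : List ℝ}, IsPath μ a T l → T - a ≤ L → ‖N.S w l‖ ≤ M' :=
    norm_S_le hM hw.bound
  set I := L * N.K * M' + N.K * (M + M') with hI
  have hI0 : 0 ≤ I := by positivity
  have hL0 := zero_le_one.trans hL
  refine ⟨M + M' + I + √(C * L), by positivity, ?_, ?_, ?_⟩
  · intro μ a T l hp hTa
    refine (norm_add_le _ _).trans ((add_le_add (hw.bound hp hTa) (hS hp hTa)).trans ?_)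
    linarith [Real.sqrt_nonneg (C * L)]
  · intro μ a b T l hab hp hTa
    have hbT := hp.le
    rw [add_sub_add_comm]
    refine (norm_add_le _ _).trans ((add_le_add (hw.incr hab hp hTa) (norm_S_incr_le hL hab
      (by linarith) (hw.bound hp (by linarith)) (hS hp (by linarith)))).trans ?_)
    rw [← add_mul]
    refine mul_le_mul_of_nonneg_right ?_ (Real.sqrt_nonneg _)
    linarith [Real.sqrt_nonneg (C * L)]
  · intro μ a T β α hμ hμ1 hr hTa
    rw [add_sub_add_comm]
    have h1 : ‖N.S w β - N.S w α‖ ≤ √(C * L) * √μ := by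
      rw [← Real.sqrt_mul (by positivity)]
      refine Real.le_sqrt_of_sq_le (((h hμ hr hμ1 hTa).2).trans ?_)
      calc _ ≤ C * μ * L := by gcongr
        _ = _ := by ring
    refine (norm_add_le _ _).trans ((add_le_add (hw.refine hμ hμ1 hr hTa) h1).trans ?_)
    rw [← add_mul]
    gcongr
    linarith

end FreeNoise

namespace FreeNoise

variable {𝓐 : Type*} [CStarAlgebra 𝓐] {N : FreeNoise 𝓐}

/-! ## The drift, annihilation and full products -/

theorem norm_pathProd_t_le {μ a T : ℝ} {l : List ℝ} (h : IsPath μ a T l) :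
    ‖pathProd N.t l‖ ≤ Real.exp (N.K * (T - a)) := by
  induction h with
  | nil => simpa using norm_one_le
  | @cons a b T l h1 h2 h3 ih =>
    rw [pathProd_cons_cons]
    have hK := mul_nonneg N.K_pos.le (sub_nonneg.2 h1.le)
    calc _ ≤ (1 + N.K * (b - a)) * Real.exp (N.K * (T - b)) :=
          (norm_mul_le _ _).trans (mul_le_mul (N.norm_t_le h1.le) ih (norm_nonneg _) (by linarith))
      _ ≤ Real.exp (N.K * (b - a)) * Real.exp (N.K * (T - b)) := by
          gcongr; linarith [Real.add_one_le_exp (N.K * (b - a))]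
      _ = _ := by rw [← Real.exp_add]; ring_nf

/-- Inserting b into [a, e] changes the drift factor by (b - a)(e - b)ψ², of size at most K²μ(b -
a), and these changes sum to O(μ). -/
theorem norm_pathProd_t_sub_le {μ a T : ℝ} {β α : List ℝ} (hμ : 0 ≤ μ) (h : Refines μ a T β α) :
    ‖pathProd N.t β - pathProd N.t α‖ ≤ Real.exp (N.K * (T - a)) * (N.K ^ 2 * μ * (T - a)) := by
  have hK := N.K_pos
  -- The claimed bound reproduces itself when one step and its insertion error are added.
  have hstep : ∀ {a b T x : ℝ}, a ≤ b → b ≤ T → 0 ≤ x →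
      x ≤ Real.exp (N.K * (T - b)) * (N.K ^ 2 * μ * (T - b)) →
      (1 + N.K * (b - a)) * x + (b - a) * (N.K ^ 2 * μ * Real.exp (N.K * (T - b)))
        ≤ Real.exp (N.K * (T - a)) * (N.K ^ 2 * μ * (T - a)) := by
    intro a b T x h1 h2 hx0 hx
    have h3 : 1 + N.K * (b - a) ≤ Real.exp (N.K * (b - a)) := by
      linarith [Real.add_one_le_exp (N.K * (b - a))]
    have h4 : Real.exp (N.K * (T - a)) = Real.exp (N.K * (b - a)) * Real.exp (N.K * (T - b)) := by
      rw [← Real.exp_add]; ring_nf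
    have h5 : 1 ≤ Real.exp (N.K * (b - a)) := Real.one_le_exp (mul_nonneg hK.le (sub_nonneg.2 h1))
    have h6 : 0 ≤ (b - a) * (N.K ^ 2 * μ * Real.exp (N.K * (T - b))) := by
      have := sub_nonneg.2 h1; positivity
    calc _ ≤ Real.exp (N.K * (b - a)) * (Real.exp (N.K * (T - b)) * (N.K ^ 2 * μ * (T - b)))
          + Real.exp (N.K * (b - a)) * ((b - a) * (N.K ^ 2 * μ * Real.exp (N.K * (T - b)))) := by
          refine add_le_add (mul_le_mul h3 hx hx0 (by positivity)) ?_
          exact le_mul_of_one_le_left h6 h5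
      _ = _ := by rw [h4]; ring
  induction h with
  | nil => simp
  | @keep a b T l l' h1 h2 h3 ih =>
    have hbT := h3.left.le
    rw [pathProd_cons_cons, pathProd_cons_cons, ← mul_sub]
    refine le_trans ?_ (hstep h1.le hbT (norm_nonneg _) ih)
    refine ((norm_mul_le _ _).trans
      (mul_le_mul_of_nonneg_right (N.norm_t_le h1.le) (norm_nonneg _))).trans ?_
    refine le_add_of_nonneg_right ?_
    have := sub_nonneg.2 h1.le
    positivity
  | @skip a b e T l l' h1 h2 h2' h3 ih =>
    have hbT := h3.left.le
    have hp : IsPath μ e T (e :: l') := by cases h3.right with | cons _ _ h => exact h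
    have e1 : pathProd N.t (a :: b :: l) - pathProd N.t (a :: e :: l')
        = N.t a b * (pathProd N.t (b :: l) - pathProd N.t (b :: e :: l'))
        + ((b - a : ℝ) : ℂ) • ((e - b : ℝ) : ℂ) • (N.ψ * (N.ψ * pathProd N.t (e :: l'))) := by
      simp only [pathProd_cons_cons]
      simp only [t, add_mul, mul_add, mul_sub, one_mul, smul_mul_assoc, mul_smul_comm,
        smul_add, smul_smul]
      push_cast
      module
    rw [e1]
    refine le_trans ?_ (hstep h1.le hbT (norm_nonneg _) ih)
    refine (norm_add_le _ _).trans (add_le_add ((norm_mul_le _ _).trans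
      (mul_le_mul_of_nonneg_right (N.norm_t_le h1.le) (norm_nonneg _))) ?_)
    rw [norm_ofReal_smul (sub_nonneg.2 h1.le), norm_ofReal_smul (sub_nonneg.2 h2.le)]
    refine mul_le_mul_of_nonneg_left ?_ (sub_nonneg.2 h1.le)
    have h4 : ‖N.ψ * (N.ψ * pathProd N.t (e :: l'))‖ ≤ N.K * (N.K * Real.exp (N.K * (T - b))) := by
      refine (norm_mul_le _ _).trans (mul_le_mul N.norm_ψ ((norm_mul_le _ _).trans
        (mul_le_mul N.norm_ψ ((norm_pathProd_t_le hp).trans ?_) (norm_nonneg _) hK.le))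
        (norm_nonneg _) hK.le)
      gcongr
    calc _ ≤ μ * (N.K * (N.K * Real.exp (N.K * (T - b)))) :=
          mul_le_mul (by linarith) h4 (norm_nonneg _) hμ
      _ = _ := by ring

variable (N) in
theorem regular_t {L : ℝ} (hL : 1 ≤ L) : ∃ M, RegularBound (pathProd N.t) L M := by
  have hK := N.K_pos
  have hL0 := zero_le_one.trans hL
  set X := Real.exp (N.K * L) with hX
  refine ⟨X + L * N.K * X + X * (N.K ^ 2 * L), by positivity, ?_, ?_, ?_⟩
  · intro μ a T l hp hTa
    have h1 : ‖pathProd N.t l‖ ≤ X := (norm_pathProd_t_le hp).trans (by rw [hX]; gcongr)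
    have h2 : 0 ≤ L * N.K * X + X * (N.K ^ 2 * L) := by positivity
    linarith
  · intro μ a b T l hab hp hTa
    have hbT := hp.le
    have h0 := sub_nonneg.2 hab.le
    have h1 : ‖pathProd N.t (b :: l)‖ ≤ X :=
      (norm_pathProd_t_le hp).trans (by rw [hX]; gcongr; linarith)
    have e : pathProd N.t (a :: b :: l) - pathProd N.t (b :: l)
        = ((b - a : ℝ) : ℂ) • (N.ψ * pathProd N.t (b :: l)) := by
      rw [pathProd_cons_cons, t, add_mul, one_mul, smul_mul_assoc]; abel
    rw [e, norm_ofReal_smul h0]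
    calc _ ≤ (L * √(b - a)) * (N.K * X) :=
          mul_le_mul (le_mul_sqrt hL h0 (by linarith)) ((norm_mul_le _ _).trans
            (mul_le_mul N.norm_ψ h1 (norm_nonneg _) hK.le)) (norm_nonneg _) (by positivity)
      _ = L * N.K * X * √(b - a) := by ring
      _ ≤ _ := by
        refine mul_le_mul_of_nonneg_right ?_ (Real.sqrt_nonneg _)
        have h2 : 0 ≤ X + X * (N.K ^ 2 * L) := by positivity
        linarith
  · intro μ a T β α hμ hμ1 hr hTa
    have hT := sub_nonneg.2 hr.left.le
    have hμ' : μ ≤ √μ := by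
      have := le_mul_sqrt le_rfl hμ hμ1
      rwa [one_mul] at this
    calc _ ≤ Real.exp (N.K * (T - a)) * (N.K ^ 2 * μ * (T - a)) := norm_pathProd_t_sub_le hμ hr
      _ ≤ X * (N.K ^ 2 * √μ * L) := by rw [hX]; gcongr
      _ = X * (N.K ^ 2 * L) * √μ := by ring
      _ ≤ _ := by
        refine mul_le_mul_of_nonneg_right ?_ (Real.sqrt_nonneg _)
        have h2 : 0 ≤ X + L * N.K * X := by positivity
        linarith

variable (N) in
/-- The annihilation part `∏ (1 + (b - a) ψ - B^*)` of the product. -/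
def W (l : List ℝ) : 𝓐 := pathProd (fun a b => N.t a b - star (N.B a b)) l

theorem pathProd_t_add_S {μ a T : ℝ} {l : List ℝ} (h : IsPath μ a T l) :
    pathProd N.t l + N.S (pathProd N.t) l = pathProd (fun a b => N.t a b + N.B a b) l := by
  induction h with
  | nil => simp [S_singleton]
  | cons h1 h2 h3 ih =>
    rw [pathProd_cons_cons (fun a b => N.t a b + N.B a b), ← ih, S_cons, pathProd_cons_cons]
    noncomm_ring

/-- S W on the path from b lies in the creators after b, so the annihilators of [a, b] kill it. What
is left of g times the tail is exactly the recursion. -/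
theorem W_add_S {μ a T : ℝ} {l : List ℝ} (h : IsPath μ a T l) :
    N.W l + N.S N.W l = pathProd N.g l := by
  induction h with
  | nil => simp [S_singleton, W]
  | @cons a b T l h1 h2 h3 ih =>
    have h0 : star (N.B a b) * N.S N.W (b :: l) = 0 :=
      (lives_B h1.le).star_mul_eq_zero (S_lives N.W h3) le_rfl
    have hW : N.W (a :: b :: l) = (N.t a b - star (N.B a b)) * N.W (b :: l) := by
      simp [W]
    rw [pathProd_cons_cons N.g, ← ih, S_cons, hW, g]
    simp only [sub_mul, add_mul, mul_add, h0]
    abel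

/-- Adjoint and time reversal turn the factors t - B^* into t + B for the reversed noise, whose
product is again a creation recursion. -/
theorem star_W {μ a T : ℝ} {l : List ℝ} (h : IsPath μ a T l) : star (N.W l)
    = pathProd N.rev.t (negRev l) + N.rev.S (pathProd N.rev.t) (negRev l) := by
  rw [pathProd_t_add_S h.negRev, W, star_pathProd]
  congr 1
  funext a b
  simp only [t, rev, star_add, star_sub, star_one, star_smul, star_star,
    RCLike.star_def, Complex.conj_ofReal]
  rw [show -a - -b = b - a by ring]; abel

-- The bound and the refinement estimate come from the reversed noise. The increment estimate does
-- not transfer, since dropping the first point becomes dropping the last one; it is computed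
-- directly.
variable (N) in
theorem regular_W {L : ℝ} (hL : 1 ≤ L) : ∃ M, RegularBound N.W L M := by
  obtain ⟨M₀, h₀⟩ := N.rev.regular_t hL
  obtain ⟨M, h⟩ := h₀.add_S hL (N := N.rev)
  have hM := h.nonneg
  have hK := N.K_pos
  have hb : ∀ {μ a T : ℝ} {l : List ℝ}, IsPath μ a T l → T - a ≤ L → ‖N.W l‖ ≤ M := by
    intro μ a T l hp hTa
    rw [← norm_star, star_W hp]
    exact h.bound hp.negRev (by linarith)
  refine ⟨M + L * N.K * M + N.K * M, by positivity, ?_, ?_, ?_⟩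
  · intro μ a T l hp hTa
    have : 0 ≤ L * N.K * M + N.K * M := by positivity
    linarith [hb hp hTa]
  · intro μ a b T l hab hp hTa
    have hbT := hp.le
    have h0 := sub_nonneg.2 hab.le
    have h1 := hb hp (by linarith)
    have e : N.W (a :: b :: l) - N.W (b :: l)
        = ((b - a : ℝ) : ℂ) • (N.ψ * N.W (b :: l)) - star (N.B a b) * N.W (b :: l) := by
      simp only [W, pathProd_cons_cons, t, add_mul, sub_mul, one_mul, smul_mul_assoc]; abel
    rw [e]
    have h2 : ‖((b - a : ℝ) : ℂ) • (N.ψ * N.W (b :: l))‖ ≤ L * N.K * M * √(b - a) := by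
      rw [norm_ofReal_smul h0]
      calc _ ≤ (L * √(b - a)) * (N.K * M) :=
            mul_le_mul (le_mul_sqrt hL h0 (by linarith)) ((norm_mul_le _ _).trans
              (mul_le_mul N.norm_ψ h1 (norm_nonneg _) hK.le)) (norm_nonneg _) (by positivity)
        _ = _ := by ring
    have h3 : ‖star (N.B a b) * N.W (b :: l)‖ ≤ N.K * M * √(b - a) := by
      calc _ ≤ (N.K * √(b - a)) * M := (norm_mul_le _ _).trans
            (mul_le_mul (by rw [norm_star]; exact N.norm_B_le hab.le) h1 (norm_nonneg _)
              (by positivity))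
        _ = _ := by ring
    refine (norm_sub_le _ _).trans ((add_le_add h2 h3).trans ?_)
    rw [← add_mul]
    refine mul_le_mul_of_nonneg_right ?_ (Real.sqrt_nonneg _)
    linarith
  · intro μ a T β α hμ hμ1 hr hTa
    have h1 : ‖N.W β - N.W α‖ ≤ M * √μ := by
      rw [← norm_star, star_sub, star_W hr.left, star_W hr.right]
      exact h.refine hμ hμ1 hr.negRev (by linarith)
    refine h1.trans (mul_le_mul_of_nonneg_right ?_ (Real.sqrt_nonneg _))
    have : 0 ≤ L * N.K * M + N.K * M := by positivity
    linarith

variable (N) in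
theorem regular_g {L : ℝ} (hL : 1 ≤ L) : ∃ M, 0 ≤ M ∧
    (∀ {μ a T : ℝ} {l : List ℝ}, IsPath μ a T l → T - a ≤ L → ‖pathProd N.g l‖ ≤ M) ∧
    ∀ {μ a T : ℝ} {β α : List ℝ}, 0 ≤ μ → μ ≤ 1 → Refines μ a T β α → T - a ≤ L →
      ‖pathProd N.g β - pathProd N.g α‖ ≤ M * √μ := by
  obtain ⟨M₀, h₀⟩ := N.regular_W hL
  obtain ⟨M, h⟩ := h₀.add_S hL (N := N)
  refine ⟨M, h.nonneg, fun hp hTa => ?_, fun hμ hμ1 hr hTa => ?_⟩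
  · rw [← W_add_S hp]; exact h.bound hp hTa
  · rw [← W_add_S hr.left, ← W_add_S hr.right]; exact h.refine hμ hμ1 hr hTa

variable (N) in
/-- On a short interval the product differs from the increment by a creation part, an
annihilation part and a remainder of second order. -/
theorem exists_decomposition : ∃ C, 0 ≤ C ∧ ∀ {a b : ℝ} {l : List ℝ} {μ : ℝ}, a < b → b - a ≤ 1 →
    IsPath μ a b l → ∃ D E : 𝓐, N.Lives a b D ∧ N.rev.Lives (-b) (-a) E ∧
      ‖D‖ ≤ C * (b - a) ∧ ‖E‖ ≤ C * (b - a) ∧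
      ‖pathProd N.g l - N.g a b - D - star E‖ ≤ C * (b - a) ^ 2 := by
  obtain ⟨M₀, h₀⟩ := N.rev.regular_t le_rfl
  obtain ⟨C₁, hC₁, h₁⟩ := S_refine (N := N.rev) le_rfl h₀
  obtain ⟨M₂, h₂⟩ := N.regular_W le_rfl
  obtain ⟨C₂, hC₂, h₂⟩ := S_refine (N := N) le_rfl h₂
  have hK := N.K_pos
  refine ⟨√C₁ + √C₂ + Real.exp N.K * N.K ^ 2, by positivity, ?_⟩
  intro a b l μ hab hb1 hl
  have h0 := (sub_nonneg.2 hab.le)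
  have hsub : [a, b].Sublist l := by
    cases hl with
    | nil => exact absurd hab (lt_irrefl _)
    | @cons _ c _ l h1 h2 h3 =>
      refine List.Sublist.cons_cons _ (List.singleton_sublist.2 ?_)
      exact List.mem_of_getLast? (isPath_iff.1 h3).2.2
  -- The coarse path is the single step [a, b], so mesh and length are both b - a and `S_refine`
  -- gives a squared bound of order (b - a)².
  have hr : Refines (b - a) a b l [a, b] :=
    .of_sublist hl (.cons hab le_rfl (.nil _)) hsub
  have sq_bound : ∀ {x C : ℝ}, 0 ≤ C → x ^ 2 ≤ C * (b - a) * (b - a) → x ≤ √C * (b - a) := by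
    intro x C hC hx
    refine abs_le_of_sq_le_sq' ?_ (by positivity) |>.2
    rw [mul_pow, Real.sq_sqrt hC]; linarith
  have hX : 0 ≤ Real.exp N.K * N.K ^ 2 := by positivity
  obtain ⟨hD, hD'⟩ := h₂ h0 hr hb1 hb1
  obtain ⟨hE, hE'⟩ := h₁ h0 hr.negRev hb1 (by linarith)
  rw [show -a - -b = b - a by ring] at hE'
  refine ⟨_, _, hD, hE, (sq_bound hC₂ hD').trans ?_, (sq_bound hC₁ hE').trans ?_, ?_⟩
  · refine mul_le_mul_of_nonneg_right ?_ h0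
    linarith [Real.sqrt_nonneg C₁]
  · refine mul_le_mul_of_nonneg_right ?_ h0
    linarith [Real.sqrt_nonneg C₂]
  · have e1 : pathProd N.g [a, b] = N.g a b := by simp
    have e2 : ∀ {β : List ℝ} {ν : ℝ}, IsPath ν a b β → star (N.rev.S (pathProd N.rev.t) (negRev β))
        = N.W β - star (pathProd N.rev.t (negRev β)) := by
      intro β ν hβ
      rw [← star_star (N.W β), star_W hβ, star_add]; abel
    rw [← e1, ← W_add_S hr.left, ← W_add_S hr.right, star_sub, e2 hr.left, e2 hr.right]
    -- With both recursion differences removed, only the difference of the drift products is left,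
    -- and it is of second order.
    have e3 : N.W l + N.S N.W l - (N.W [a, b] + N.S N.W [a, b]) - (N.S N.W l - N.S N.W [a, b])
        - (N.W l - star (pathProd N.rev.t (negRev l))
          - (N.W [a, b] - star (pathProd N.rev.t (negRev [a, b]))))
        = star (pathProd N.rev.t (negRev l) - pathProd N.rev.t (negRev [a, b])) := by
      rw [star_sub]; abel
    rw [e3, norm_star]
    refine (norm_pathProd_t_sub_le h0 hr.negRev).trans ?_
    have hKr : N.rev.K = N.K := rfl
    rw [hKr, show -a - -b = b - a by ring]
    have h4 : Real.exp (N.K * (b - a)) ≤ Real.exp N.K := by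
      rw [Real.exp_le_exp]; nlinarith
    calc _ ≤ Real.exp N.K * (N.K ^ 2 * (b - a) * (b - a)) := by gcongr
      _ = Real.exp N.K * N.K ^ 2 * (b - a) ^ 2 := by ring
      _ ≤ _ := by
        refine mul_le_mul_of_nonneg_right ?_ (by positivity)
        linarith [Real.sqrt_nonneg C₁, Real.sqrt_nonneg C₂]

end FreeNoise

/-! ## Partitions as paths -/

theorem IsPath.mem_Icc {μ a T : ℝ} {l : List ℝ} (h : IsPath μ a T l) {x : ℝ} (hx : x ∈ l) :
    x ∈ Set.Icc a T := by
  induction h with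
  | nil => simpa using hx
  | cons h1 h2 h3 ih =>
    rcases List.mem_cons.1 hx with rfl | hx
    · exact ⟨le_rfl, h1.le.trans h3.le⟩
    · exact ⟨h1.le.trans (ih hx).1, (ih hx).2⟩

theorem IsPath.left_mem {μ a T : ℝ} {l : List ℝ} (h : IsPath μ a T l) : a ∈ l :=
  List.mem_of_head? (isPath_iff.1 h).2.1

theorem IsPath.right_mem {μ a T : ℝ} {l : List ℝ} (h : IsPath μ a T l) : T ∈ l :=
  List.mem_of_getLast? (isPath_iff.1 h).2.2

theorem exists_isPath {μ a T : ℝ} (hμ : 0 < μ) (h : a ≤ T) : ∃ l, IsPath μ a T l := by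
  obtain ⟨n, hn⟩ := exists_nat_ge ((T - a) / μ)
  rw [div_le_iff₀ hμ] at hn
  induction n generalizing a with
  | zero =>
    obtain rfl : a = T := by push_cast at hn; linarith
    exact ⟨_, .nil _⟩
  | succ n ih =>
    rcases h.eq_or_lt with rfl | hlt
    · exact ⟨_, .nil _⟩
    · rcases le_or_gt (T - a) μ with h1 | h1
      · exact ⟨_, .cons hlt h1 (.nil _)⟩
      · obtain ⟨l, hl⟩ := ih (a := a + μ) (by linarith) (by push_cast at hn; linarith)
        cases l with
        | nil => cases hl
        | cons x l =>
          obtain rfl := hl.head_eq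
          exact ⟨_, .cons (by linarith) (by linarith) hl⟩

theorem isPath_of_pairwise {r s : ℝ} {l : List ℝ} (h : l.Pairwise (· < ·)) (hr : r ∈ l)
    (hs : s ∈ l) (hl : ∀ x ∈ l, r ≤ x ∧ x ≤ s) : IsPath (s - r) r s l := by
  rw [isPath_iff]
  refine ⟨?_, ?_, ?_⟩
  · rw [List.isChain_iff_getElem]
    intro i hi
    have h1 := List.pairwise_iff_getElem.1 h i (i + 1) (by omega) hi (by omega)
    have h2 := hl _ (List.getElem_mem (show i < l.length by omega))
    have h3 := hl _ (List.getElem_mem hi)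
    exact ⟨h1, by linarith [h2.1, h3.2]⟩
  · cases l with
    | nil => simp at hr
    | cons x l =>
      rcases List.mem_cons.1 hr with rfl | hm
      · rfl
      · exact absurd (hl x (by simp)).1 (not_le.2 (List.rel_of_pairwise_cons h hm))
  · obtain ⟨l, x, rfl⟩ : ∃ l' x, l = l' ++ [x] := by
      rcases List.eq_nil_or_concat l with rfl | ⟨l', x, rfl⟩
      · simp at hr
      · exact ⟨l', x, by simp⟩
    have hx := (hl x (by simp)).2
    rcases List.mem_append.1 hs with hm | hm
    · exact absurd hx (not_le.2 ((List.pairwise_append.1 h).2.2 s hm x (by simp)))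
    · have : s = x := by simpa using hm
      simp [this]

namespace IntervalPartition

variable {r s : ℝ}

instance : IsDirectedOrder (IntervalPartition r s) where
  directed α β := by
    refine ⟨⟨α.1 ∪ β.1, Finset.mem_union_left _ α.2.1, Finset.mem_union_left _ α.2.2.1,
      fun t ht => ?_⟩, Finset.subset_union_left (s₁ := α.1), Finset.subset_union_right (s₂ := β.1)⟩
    rcases Finset.mem_union.1 ht with h | h
    · exact α.2.2.2 t h
    · exact β.2.2.2 t h

theorem isPath (α : IntervalPartition r s) : IsPath (s - r) r s (α.1.sort (· ≤ ·)) := by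
  refine isPath_of_pairwise α.1.sortedLT_sort.pairwise ?_ ?_ fun x hx => ?_
  · exact (Finset.mem_sort _).2 α.2.1
  · exact (Finset.mem_sort _).2 α.2.2.1
  · exact α.2.2.2 x ((Finset.mem_sort _).1 hx)

theorem exists_sort_eq {μ : ℝ} {l : List ℝ} (h : IsPath μ r s l) :
    ∃ α : IntervalPartition r s, α.1.sort (· ≤ ·) = l := by
  have hl := h.pairwise
  refine ⟨⟨l.toFinset, List.mem_toFinset.2 h.left_mem, List.mem_toFinset.2 h.right_mem,
    fun t ht => h.mem_Icc (List.mem_toFinset.1 ht)⟩, ?_⟩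
  exact (List.toFinset_sort (· ≤ ·) (hl.imp fun h => h.ne)).2 (hl.imp fun h => h.le)

theorem exists_mesh_le {μ : ℝ} (hμ : 0 < μ) (h : r ≤ s) :
    ∃ α : IntervalPartition r s, IsPath μ r s (α.1.sort (· ≤ ·)) := by
  obtain ⟨l, hl⟩ := exists_isPath hμ h
  obtain ⟨α, hα⟩ := exists_sort_eq hl
  exact ⟨α, hα ▸ hl⟩

theorem refines {μ : ℝ} {α β : IntervalPartition r s} (h : α ≤ β)
    (hα : IsPath μ r s (α.1.sort (· ≤ ·))) :
    Refines μ r s (β.1.sort (· ≤ ·)) (α.1.sort (· ≤ ·)) := by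
  refine .of_sublist β.isPath hα ?_
  refine List.sublist_of_subperm_of_sortedLE (List.subperm_of_subset (Finset.sort_nodup _ _) ?_)
    α.1.sortedLT_sort.sortedLE β.1.sortedLT_sort.sortedLE
  intro x hx
  exact (Finset.mem_sort _).2 (h ((Finset.mem_sort _).1 hx))

theorem neBot_atTop (h : r ≤ s) : (atTop : Filter (IntervalPartition r s)).NeBot := by
  obtain ⟨α, -⟩ := exists_mesh_le zero_lt_one h
  have : Nonempty (IntervalPartition r s) := ⟨α⟩
  exact atTop_neBot

end IntervalPartition

namespace FreeNoise

variable {𝓐 : Type*} [CStarAlgebra 𝓐] {N : FreeNoise 𝓐}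

/-! ## Unitarity -/

variable (N) in
/-- The remainder of `g g^* - 1`. -/
def defect (a b : ℝ) : 𝓐 :=
  ((b - a : ℝ) : ℂ) • ((N.B a b - star (N.B a b)) * star N.ψ
    + N.ψ * (star (N.B a b) - N.B a b) + ((b - a : ℝ) : ℂ) • (N.ψ * star N.ψ))

variable (N) in
/-- The factor `x` in `g g^* - 1 = B x + (B x)^* + defect`. -/
def cofactor (a b : ℝ) : 𝓐 := (2⁻¹ : ℂ) • star (N.B a b) - N.B a b

/-- The first-order scalar part B^*B + h(ψ + ψ^*) vanishes by `unit`. Splitting BB^* into two halves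
writes BB^* - BB - B^*B^* as Bx plus its adjoint. -/
theorem g_mul_star_g {a b : ℝ} (ha : a ∈ N.dom) (hb : b ∈ N.dom) (hab : a ≤ b) :
    N.g a b * star (N.g a b) = 1 + N.B a b * N.cofactor a b + star (N.B a b * N.cofactor a b)
      + N.defect a b := by
  have h : star (N.B a b) * N.B a b = -(((b - a : ℝ) : ℂ) • (N.ψ + star N.ψ)) :=
    eq_neg_of_add_eq_zero_left (N.unit ha hb hab)
  have e : N.g a b * star (N.g a b) - (1 + N.B a b * N.cofactor a b
      + star (N.B a b * N.cofactor a b) + N.defect a b)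
      = star (N.B a b) * N.B a b + ((b - a : ℝ) : ℂ) • (N.ψ + star N.ψ) := by
    simp only [g, t, cofactor, defect, star_add, star_sub, star_one, star_smul, star_star, star_mul,
      RCLike.star_def, Complex.conj_ofReal, add_mul, mul_add, sub_mul, mul_sub, one_mul, mul_one,
      smul_mul_assoc, mul_smul_comm, smul_add, smul_sub, smul_smul, map_inv₀, Complex.conj_ofNat]
    module
  rw [N.unit ha hb hab] at e
  exact sub_eq_zero.1 e

theorem norm_defect_le {a b : ℝ} (hab : a ≤ b) (h1 : b - a ≤ 1) :
    ‖N.defect a b‖ ≤ 5 * N.K ^ 2 * ((b - a) * √(b - a)) := by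
  have h0 := sub_nonneg.2 hab
  have hK := N.K_pos
  have hB := N.norm_B_le hab
  have hψ := N.norm_ψ
  have hs : b - a ≤ √(b - a) := by simpa using le_mul_sqrt le_rfl h0 h1
  have h2 : ∀ x y : 𝓐, ‖x‖ ≤ N.K * √(b - a) → ‖y‖ ≤ N.K * √(b - a) →
      ‖x - y‖ ≤ 2 * N.K * √(b - a) := fun x y hx hy =>
    (norm_sub_le _ _).trans (by linarith)
  have hB' : ‖star (N.B a b)‖ ≤ N.K * √(b - a) := by rwa [norm_star]
  rw [defect, norm_ofReal_smul h0]
  have h3 : ‖(N.B a b - star (N.B a b)) * star N.ψ‖ ≤ 2 * N.K * √(b - a) * N.K :=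
    (norm_mul_le _ _).trans (mul_le_mul (h2 _ _ hB hB') (by rwa [norm_star]) (norm_nonneg _)
      (by positivity))
  have h4 : ‖N.ψ * (star (N.B a b) - N.B a b)‖ ≤ N.K * (2 * N.K * √(b - a)) :=
    (norm_mul_le _ _).trans (mul_le_mul hψ (h2 _ _ hB' hB) (norm_nonneg _) hK.le)
  have h5 : ‖((b - a : ℝ) : ℂ) • (N.ψ * star N.ψ)‖ ≤ √(b - a) * (N.K * N.K) := by
    rw [norm_ofReal_smul h0]
    exact mul_le_mul hs ((norm_mul_le _ _).trans (mul_le_mul hψ (by rwa [norm_star])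
      (norm_nonneg _) hK.le)) (norm_nonneg _) (Real.sqrt_nonneg _)
  calc _ ≤ (b - a) * (2 * N.K * √(b - a) * N.K + N.K * (2 * N.K * √(b - a))
        + √(b - a) * (N.K * N.K)) := by
        refine mul_le_mul_of_nonneg_left ?_ h0
        exact (norm_add_le _ _).trans (add_le_add ((norm_add_le _ _).trans (add_le_add h3 h4)) h5)
    _ = _ := by ring

theorem norm_cofactor_le {a b : ℝ} (hab : a ≤ b) : ‖N.cofactor a b‖ ≤ 2 * N.K * √(b - a) := by
  have hB := N.norm_B_le hab
  have h1 : ‖(2⁻¹ : ℂ) • star (N.B a b)‖ ≤ ‖N.B a b‖ := by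
    rw [norm_smul, norm_star]
    refine mul_le_of_le_one_left (norm_nonneg _) ?_
    norm_num
  exact (norm_sub_le _ _).trans (by linarith)

/-- The C*-identity with the expansion of gg^* gives 1 + O(h), where the triangle inequality for g
would only give 1 + O(√h). The 9 is 2 + 2 + 5. -/
theorem norm_g_le {a b : ℝ} (ha : a ∈ N.dom) (hb : b ∈ N.dom) (hab : a ≤ b) (h1 : b - a ≤ 1) :
    ‖N.g a b‖ ≤ 1 + 9 * N.K ^ 2 * (b - a) := by
  have h0 := sub_nonneg.2 hab
  have hK := N.one_le_K
  have hs := Real.mul_self_sqrt h0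
  have hs1 : √(b - a) ≤ 1 := Real.sqrt_le_one.2 h1
  have h2 : ‖N.B a b * N.cofactor a b‖ ≤ 2 * N.K ^ 2 * (b - a) := by
    calc _ ≤ (N.K * √(b - a)) * (2 * N.K * √(b - a)) := (norm_mul_le _ _).trans
          (mul_le_mul (N.norm_B_le hab) (norm_cofactor_le hab) (norm_nonneg _)
            (mul_nonneg N.K_pos.le (Real.sqrt_nonneg _)))
      _ = 2 * N.K ^ 2 * (√(b - a) * √(b - a)) := by ring
      _ = _ := by rw [hs]
  have h3 : ‖N.defect a b‖ ≤ 5 * N.K ^ 2 * (b - a) := by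
    refine (norm_defect_le hab h1).trans ?_
    gcongr
    exact mul_le_of_le_one_right h0 hs1
  have h4 : ‖N.g a b‖ ^ 2 ≤ 1 + 9 * N.K ^ 2 * (b - a) := by
    rw [sq, ← CStarRing.norm_self_mul_star, g_mul_star_g ha hb hab]
    refine (norm_add_le _ _).trans ((add_le_add ((norm_add_le _ _).trans (add_le_add
      ((norm_add_le _ _).trans (add_le_add norm_one_le h2)) ((norm_star _).trans_le h2))) h3).trans
        (by linarith))
  have h5 : 0 ≤ 9 * N.K ^ 2 * (b - a) := by positivity
  nlinarith [norm_nonneg (N.g a b)]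

-- Along the path PP^* - 1 is kept in the form Q + Q^* + R with Q a creation part. Q is controlled
-- by the energy estimate and R by summing the defects, which are O(h√μ) each.
variable (N) in
theorem norm_mul_star_sub_one_le {L : ℝ} : ∃ C, 0 ≤ C ∧
    ∀ {μ a T : ℝ} {l : List ℝ}, 0 ≤ μ → μ ≤ 1 → IsPath μ a T l → T - a ≤ L → (∀ x ∈ l, x ∈ N.dom) →
      ‖pathProd N.g l * star (pathProd N.g l) - 1‖ ≤ C * √μ := by
  have hK1 := N.one_le_K
  have hK := N.K_pos
  set G := 9 * N.K ^ 2 with hG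
  have hG0 : 0 ≤ G := by positivity
  -- Chosen so that (1 + Kh)(1 + Gh) ≤ 1 + K'h for 0 ≤ h ≤ 1.
  set K' := N.K + G + N.K * G with hK'
  have hK'0 : 0 ≤ K' := by positivity
  set A := energyRate K' L with hA
  refine ⟨(2 * (Real.exp (|A| * |L|) * (2 * N.K))
    + Real.exp (2 * G * |L|) * (|L| * (5 * N.K ^ 2))), by positivity, ?_⟩
  intro μ a T l hμ hμ1 hl hTa hdom
  set ε := 2 * N.K * √μ with hε
  have hε0 : 0 ≤ ε := by positivity
  have hT := hl.le
  have hL : 0 ≤ L := by linarith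
  have key : ∃ Q R : 𝓐, pathProd N.g l * star (pathProd N.g l) - 1 = Q + star Q + R ∧
      N.Lives a T Q ∧ ‖Q‖ ^ 2 + ε ^ 2 ≤ Real.exp (A * (T - a)) * ε ^ 2 ∧
      ‖R‖ ≤ Real.exp (2 * G * (T - a)) * ((T - a) * (5 * N.K ^ 2 * √μ)) := by
    induction hl with
    | nil => exact ⟨0, 0, by simp, lives_zero _ _, by simp, by simp⟩
    | @cons a b T l h1 h2 h3 ih =>
      have hbT := h3.le
      obtain ⟨Q, R, e, hQ, hQ', hR⟩ := ih (by linarith) (fun x hx => hdom x (by simp [hx])) hbT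
      have ha : a ∈ N.dom := hdom a (by simp)
      have hb : b ∈ N.dom := hdom b (by simp)
      have h0 := sub_nonneg.2 h1.le
      have hg := norm_g_le ha hb h1.le (by linarith)
      rw [← hG] at hg
      have hsq : √(b - a) ≤ √μ := Real.sqrt_le_sqrt h2
      have hBQ : star (N.B a b) * Q = 0 := (lives_B h1.le).star_mul_eq_zero hQ le_rfl
      -- The annihilators in g kill Q, so the new creation part splits into a drift term and a term
      -- beginning with the creator of [a, b], as `energy_step` requires.
      have hgQ : N.g a b * Q * star (N.g a b) + N.B a b * N.cofactor a b
          = N.t a b * Q * star (N.g a b)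
            + N.B a b * (Q * star (N.g a b) + N.cofactor a b) := by
        have : N.g a b * Q = N.t a b * Q + N.B a b * Q := by
          rw [g, add_mul, sub_mul, hBQ, sub_zero]
        rw [this]; noncomm_ring
      refine ⟨N.g a b * Q * star (N.g a b) + N.B a b * N.cofactor a b,
        N.g a b * R * star (N.g a b) + N.defect a b, ?_, ?_, ?_, ?_⟩
      · have e' : pathProd N.g (b :: l) * star (pathProd N.g (b :: l)) = 1 + (Q + star Q + R) := by
          rw [← e]; abel
        rw [pathProd_cons_cons, star_mul]
        have e2 : N.g a b * pathProd N.g (b :: l) * (star (pathProd N.g (b :: l)) * star (N.g a b))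
            = N.g a b * (pathProd N.g (b :: l) * star (pathProd N.g (b :: l))) * star (N.g a b) := by
          simp only [mul_assoc]
        rw [e2, e']
        have e3 : N.g a b * (1 + (Q + star Q + R)) * star (N.g a b)
            = N.g a b * star (N.g a b) + N.g a b * Q * star (N.g a b)
              + N.g a b * star Q * star (N.g a b) + N.g a b * R * star (N.g a b) := by
          noncomm_ring
        rw [e3, g_mul_star_g ha hb h1.le]
        simp only [star_add, star_mul, star_star, mul_assoc]
        abel
      · rw [hgQ]
        exact (((hQ.scalar_mul (N.t_mem _ _)).mul _).mono h1.le le_rfl).add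
          (((lives_B h1.le).mul _).mono le_rfl hbT)
      · rw [hgQ]
        refine (energy_step (L := L) (K := K') (x := ‖Q‖) h1.le (by linarith) ?_ ?_ ?_ ?_).trans ?_
        · rw [hK']; nlinarith [mul_nonneg hK.le hG0]
        · rw [← mul_assoc, (lives_B h1.le).star_mul_eq_zero (hQ.scalar_mul (N.t_mem _ _)) le_rfl,
            zero_mul]
        · have h5 : ‖N.t a b * Q * star (N.g a b)‖
              ≤ ((1 + N.K * (b - a)) * ‖Q‖) * (1 + G * (b - a)) := by
            refine (norm_mul_le _ _).trans (mul_le_mul ((norm_mul_le _ _).trans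
              (mul_le_mul_of_nonneg_right (N.norm_t_le h1.le) (norm_nonneg _)))
              (by rwa [norm_star]) (norm_nonneg _) (by positivity))
          refine h5.trans (le_trans ?_ (le_add_of_nonneg_right (mul_nonneg h0 hε0)))
          have h6 : (1 + N.K * (b - a)) * (1 + G * (b - a)) ≤ 1 + K' * (b - a) := by
            have : (b - a) * (b - a) ≤ (b - a) := mul_le_of_le_one_left h0 (by linarith)
            nlinarith [mul_le_mul_of_nonneg_left this (mul_nonneg hK.le hG0)]
          nlinarith [mul_le_mul_of_nonneg_right h6 (norm_nonneg Q)]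
        · refine (norm_add_le _ _).trans (add_le_add ?_ ?_)
          · refine (norm_mul_le _ _).trans ?_
            rw [mul_comm, norm_star]
            refine mul_le_mul_of_nonneg_right (hg.trans ?_) (norm_nonneg _)
            have : G * (b - a) ≤ G := mul_le_of_le_one_right hG0 (by linarith)
            nlinarith [mul_nonneg hK.le hG0]
          · exact (norm_cofactor_le h1.le).trans (by rw [hε]; gcongr)
        · calc _ ≤ Real.exp (A * (b - a)) * (Real.exp (A * (T - b)) * ε ^ 2) := by gcongr
            _ = _ := by rw [← mul_assoc, ← Real.exp_add]; ring_nf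
      · have h5 : 1 + G * (b - a) ≤ Real.exp (G * (b - a)) := by
          linarith [Real.add_one_le_exp (G * (b - a))]
        have h6 : ‖N.g a b * R * star (N.g a b)‖ ≤ Real.exp (2 * G * (b - a)) * ‖R‖ := by
          calc _ ≤ (Real.exp (G * (b - a)) * ‖R‖) * Real.exp (G * (b - a)) := by
                refine (norm_mul_le _ _).trans (mul_le_mul ((norm_mul_le _ _).trans
                  (mul_le_mul_of_nonneg_right (hg.trans h5) (norm_nonneg _)))
                  (by rw [norm_star]; exact hg.trans h5) (norm_nonneg _) (by positivity))
            _ = (Real.exp (G * (b - a)) * Real.exp (G * (b - a))) * ‖R‖ := by ring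
            _ = _ := by rw [← Real.exp_add]; ring_nf
        have h7 : ‖N.defect a b‖ ≤ (b - a) * (5 * N.K ^ 2 * √μ) := by
          refine (norm_defect_le h1.le (by linarith)).trans ?_
          calc _ ≤ 5 * N.K ^ 2 * ((b - a) * √μ) := by gcongr
            _ = _ := by ring
        have h8 : 1 ≤ Real.exp (2 * G * (T - a)) :=
          Real.one_le_exp (mul_nonneg (by positivity) (by linarith))
        have h9 : 0 ≤ (b - a) * (5 * N.K ^ 2 * √μ) := by positivity
        calc _ ≤ Real.exp (2 * G * (b - a)) * (Real.exp (2 * G * (T - b)) *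
              ((T - b) * (5 * N.K ^ 2 * √μ)))
              + Real.exp (2 * G * (T - a)) * ((b - a) * (5 * N.K ^ 2 * √μ)) := by
              refine (norm_add_le _ _).trans (add_le_add (h6.trans ?_) (h7.trans ?_))
              · gcongr
              · exact le_mul_of_one_le_left h9 h8
          _ = _ := by
            rw [← mul_assoc, ← Real.exp_add,
              show 2 * G * (b - a) + 2 * G * (T - b) = 2 * G * (T - a) by ring]
            ring
  obtain ⟨Q, R, e, -, hQ, hR⟩ := key
  have hQ1 : ‖Q‖ ≤ Real.exp (|A| * |L|) * ε := by
    refine norm_le_of_sq_add_le hε0 (hQ.trans ?_)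
    have : A * (T - a) ≤ |A| * |L| := (le_abs_self _).trans (by
      rw [abs_mul]
      exact mul_le_mul_of_nonneg_left (by
        rw [abs_of_nonneg (sub_nonneg.2 hT), abs_of_nonneg hL]; exact hTa) (abs_nonneg _))
    gcongr
  have hR1 : ‖R‖ ≤ Real.exp (2 * G * |L|) * (|L| * (5 * N.K ^ 2 * √μ)) := by
    refine hR.trans ?_
    have h1 := hTa.trans (le_abs_self L)
    gcongr
  rw [e]
  refine (norm_add_le _ _).trans ((add_le_add ((norm_add_le _ _).trans
    (add_le_add hQ1 ((norm_star _).trans_le hQ1))) hR1).trans_eq ?_)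
  rw [hε]; ring

-- The adjoint of P is the product of the reversed noise, which exchanges the two unitarity
-- relations.
variable (N) in
theorem norm_star_mul_sub_one_le {L : ℝ} : ∃ C, 0 ≤ C ∧
    ∀ {μ a T : ℝ} {l : List ℝ}, 0 ≤ μ → μ ≤ 1 → IsPath μ a T l → T - a ≤ L → (∀ x ∈ l, x ∈ N.dom) →
      ‖star (pathProd N.g l) * pathProd N.g l - 1‖ ≤ C * √μ := by
  obtain ⟨C, hC, h⟩ := N.rev.norm_mul_star_sub_one_le (L := L)
  refine ⟨C, hC, fun {μ a T l} hμ hμ1 hl hTa hdom => ?_⟩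
  have e : star (pathProd N.g l) = pathProd N.rev.g (negRev l) := by
    rw [star_pathProd]
    congr 1
    funext a b
    rw [star_g, neg_neg, neg_neg]
  have := h hμ hμ1 hl.negRev (by linarith) (fun x hx => by
    have hx' : ∃ y ∈ l, -y = x := by simpa [negRev] using hx
    obtain ⟨y, hy, rfl⟩ := hx'
    change - -y ∈ N.dom
    rw [neg_neg]; exact hdom y hy)
  rwa [← e, star_star] at this

/-! ## The limit over partitions -/

variable (N) in
theorem exists_tendsto {r s : ℝ} (h : r ≤ s) :
    ∃ U : 𝓐, Tendsto (fun α : IntervalPartition r s => α.prod N.g) atTop (𝓝 U) := by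
  have := IntervalPartition.neBot_atTop h
  obtain ⟨M, hM, -, hM'⟩ := N.regular_g (L := 1 + (s - r)) (by linarith)
  refine CompleteSpace.complete (Metric.cauchy_iff.2 ⟨inferInstance, fun ε hε => ?_⟩)
  obtain ⟨μ, hμ, hμ1, hμε⟩ : ∃ μ : ℝ, 0 < μ ∧ μ ≤ 1 ∧ 2 * (M * √μ) < ε := by
    have : Tendsto (fun μ : ℝ => 2 * (M * √μ)) (𝓝[>] 0) (𝓝 (2 * (M * √0))) :=
      ((Continuous.tendsto (by fun_prop) 0).mono_left nhdsWithin_le_nhds)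
    simp only [Real.sqrt_zero, mul_zero] at this
    obtain ⟨μ, h1, h2, h3⟩ := ((this.eventually_lt_const hε).and
      (Ioc_mem_nhdsGT zero_lt_one)).exists
    exact ⟨μ, h2, h3, h1⟩
  -- Every partition beyond α refines a path of mesh μ, so its product is within M√μ of that of α.
  obtain ⟨α, hα⟩ := IntervalPartition.exists_mesh_le hμ h
  have key : ∀ β : IntervalPartition r s, α ≤ β → ‖β.prod N.g - α.prod N.g‖ ≤ M * √μ :=
    fun β hβ => hM' hμ.le hμ1 (IntervalPartition.refines hβ hα) (by linarith)
  refine ⟨_, image_mem_map (Ici_mem_atTop α), ?_⟩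
  rintro _ ⟨β, hβ, rfl⟩ _ ⟨γ, hγ, rfl⟩
  rw [dist_eq_norm, ← sub_sub_sub_cancel_right _ _ (α.prod N.g)]
  exact (norm_sub_le _ _).trans_lt (by linarith [key β hβ, key γ hγ])

theorem isUnitary_of_tendsto {r s : ℝ} (h : r ≤ s) (hdom : Set.Icc r s ⊆ N.dom) {U : 𝓐}
    (hU : Tendsto (fun α : IntervalPartition r s => α.prod N.g) atTop (𝓝 U)) :
    U * star U = 1 ∧ star U * U = 1 := by
  have := IntervalPartition.neBot_atTop h
  have aux : ∀ {f : IntervalPartition r s → 𝓐} {y : 𝓐} {C : ℝ}, 0 ≤ C → Tendsto f atTop (𝓝 y) →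
      (∀ μ, 0 < μ → μ ≤ 1 → ∀ α : IntervalPartition r s, IsPath μ r s (α.1.sort (· ≤ ·)) →
        ‖f α - 1‖ ≤ C * √μ) → y = 1 := by
    intro f y C hC hf hb
    have h1 : ∀ μ ∈ Set.Ioc (0 : ℝ) 1, ‖y - 1‖ ≤ C * √μ := by
      rintro μ ⟨hμ, hμ1⟩
      refine le_of_tendsto (hf.sub_const 1).norm ?_
      obtain ⟨α, hα⟩ := IntervalPartition.exists_mesh_le hμ h
      filter_upwards [Ici_mem_atTop α] with β hβ
      refine hb μ hμ hμ1 β ?_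
      have hr := IntervalPartition.refines hβ hα
      exact hr.left
    have h2 : Tendsto (fun μ : ℝ => C * √μ) (𝓝[>] 0) (𝓝 (C * √0)) :=
      ((Continuous.tendsto (by fun_prop) 0).mono_left nhdsWithin_le_nhds)
    simp only [Real.sqrt_zero, mul_zero] at h2
    have h3 := ge_of_tendsto h2 (eventually_of_mem (Ioc_mem_nhdsGT zero_lt_one) h1)
    exact sub_eq_zero.1 (norm_le_zero_iff.1 h3)
  obtain ⟨C₁, hC₁, h₁⟩ := N.norm_mul_star_sub_one_le (L := s - r)
  obtain ⟨C₂, hC₂, h₂⟩ := N.norm_star_mul_sub_one_le (L := s - r)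
  exact ⟨aux hC₁ (hU.mul hU.star) fun μ hμ hμ1 α hα => h₁ hμ.le hμ1 hα le_rfl
      fun x hx => hdom (hα.mem_Icc hx),
    aux hC₂ (hU.star.mul hU) fun μ hμ hμ1 α hα => h₂ hμ.le hμ1 hα le_rfl
      fun x hx => hdom (hα.mem_Icc hx)⟩

/-! ### Recovering the increments from the limits -/

theorem g_sub_one_add {a b c : ℝ} (h1 : a ≤ b) (h2 : b ≤ c) :
    N.g a c - 1 = (N.g a b - 1) + (N.g b c - 1) := by
  rw [g, g, g, N.B_add h1 h2, star_add]
  simp only [t]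
  push_cast
  module

/-- The increment `g - 1` is a limit of sums of `U - 1` along partitions. -/
theorem g_sub_one_mem {r s : ℝ} (h : r ≤ s) {U : ℝ → ℝ → 𝓐}
    (hU : ∀ a b : ℝ, r ≤ a → a < b →
      Tendsto (fun α : IntervalPartition a b => α.prod N.g) atTop (𝓝 (U a b)))
    (P : AddSubmonoid 𝓐) (hP : IsClosed (P : Set 𝓐))
    (hUP : ∀ a b : ℝ, r ≤ a → a < b → U a b - 1 ∈ P) : N.g r s - 1 ∈ P := by
  obtain ⟨C, hC, hdec⟩ := N.exists_decomposition
  have hdec' : ∀ a b : ℝ, r ≤ a → a < b → b - a ≤ 1 → ∃ D E : 𝓐, N.Lives a b D ∧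
      N.rev.Lives (-b) (-a) E ∧ ‖D‖ ≤ C * (b - a) ∧ ‖E‖ ≤ C * (b - a) ∧
      ‖U a b - N.g a b - D - star E‖ ≤ (C + 1) * (b - a) ^ 2 := by
    intro a b ha hab hab1
    have := IntervalPartition.neBot_atTop hab.le
    -- D and E need not converge along the net: a single partition whose product is within (b - a)²
    -- of the limit suffices.
    have h0 : 0 < (b - a) ^ 2 := by have := sub_pos.2 hab; positivity
    obtain ⟨α, hα⟩ := (Metric.tendsto_nhds.1 (hU a b ha hab) _ h0).exists
    obtain ⟨D, E, hD, hE, hD', hE', hZ⟩ := hdec hab hab1 α.isPath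
    refine ⟨D, E, hD, hE, hD', hE', ?_⟩
    rw [dist_comm, dist_eq_norm] at hα
    have e : U a b - N.g a b - D - star E
        = (pathProd N.g (α.1.sort (· ≤ ·)) - N.g a b - D - star E) + (U a b - α.prod N.g) := by
      change _ = (α.prod N.g - N.g a b - D - star E) + (U a b - α.prod N.g)
      abel
    rw [e]
    exact (norm_add_le _ _).trans (by linarith)
  -- x is the sum of U - 1 along the path; D and E collect the creation and annihilation errors of
  -- its steps.
  have key : ∀ {μ a : ℝ} {l : List ℝ}, 0 ≤ μ → μ ≤ 1 → r ≤ a → IsPath μ a s l →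
      ∃ x ∈ P, ∃ D E : 𝓐, N.Lives a s D ∧ N.rev.Lives (-s) (-a) E ∧
        ‖D‖ ^ 2 ≤ C ^ 2 * μ * (s - a) ∧ ‖E‖ ^ 2 ≤ C ^ 2 * μ * (s - a) ∧
        ‖x - (N.g a s - 1) - D - star E‖ ≤ (C + 1) * μ * (s - a) := by
    intro μ a l hμ hμ1 ha hl
    induction hl with
    | nil a =>
      refine ⟨0, zero_mem _, 0, 0, lives_zero _ _, lives_zero _ _, by simp, by simp, ?_⟩
      have hB : N.B a a = 0 := by
        have := N.B_add (le_refl a) (le_refl a)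
        simpa using this
      simp [g, t, hB]
    | @cons a b T l h1 h2 h3 ih =>
      have hbT := h3.le
      obtain ⟨x, hx, D, E, hD, hE, hD', hE', hZ⟩ := ih (by linarith) (by linarith)
      obtain ⟨D₁, E₁, hD₁, hE₁, hD₁', hE₁', hZ₁⟩ := hdec' a b ha h1 (by linarith)
      have h0 := sub_nonneg.2 h1.le
      have hsq : (b - a) ^ 2 ≤ μ * (b - a) := by rw [sq]; gcongr
      refine ⟨(U a b - 1) + x, add_mem (hUP a b ha h1) hx, D₁ + D, E + E₁,
        (hD₁.mono le_rfl hbT).add (hD.mono h1.le le_rfl),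
        (hE.mono le_rfl (by linarith)).add (hE₁.mono (by linarith) le_rfl), ?_, ?_, ?_⟩
      -- By orthogonality the squares C²(b - a)² add up to at most C²μ(s - a); adding the norms
      -- would leave O(1).
      · refine (norm_sq_add_le (hD₁.star_mul_eq_zero hD le_rfl)).trans ?_
        have : ‖D₁‖ ^ 2 ≤ C ^ 2 * (μ * (b - a)) := by
          calc _ ≤ (C * (b - a)) ^ 2 := by gcongr
            _ = C ^ 2 * (b - a) ^ 2 := by ring
            _ ≤ _ := by gcongr
        linarith
      · refine (norm_sq_add_le (hE.star_mul_eq_zero hE₁ le_rfl)).trans ?_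
        have : ‖E₁‖ ^ 2 ≤ C ^ 2 * (μ * (b - a)) := by
          calc _ ≤ (C * (b - a)) ^ 2 := by gcongr
            _ = C ^ 2 * (b - a) ^ 2 := by ring
            _ ≤ _ := by gcongr
        linarith
      · rw [g_sub_one_add h1.le hbT]
        have e : U a b - 1 + x - (N.g a b - 1 + (N.g b T - 1)) - (D₁ + D) - star (E + E₁)
            = (U a b - N.g a b - D₁ - star E₁) + (x - (N.g b T - 1) - D - star E) := by
          rw [star_add]; abel
        rw [e]
        refine (norm_add_le _ _).trans ((add_le_add (hZ₁.trans
          (mul_le_mul_of_nonneg_left hsq (by linarith))) hZ).trans_eq ?_)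
        ring
  refine hP.closure_subset (Metric.mem_closure_iff.2 fun ε hε => ?_)
  set X := s - r with hX
  have hX0 : 0 ≤ X := sub_nonneg.2 h
  obtain ⟨μ, hμ, hμ1, hμε⟩ : ∃ μ : ℝ, 0 < μ ∧ μ ≤ 1 ∧
      (C + 1) * μ * X + √(C ^ 2 * μ * X) + √(C ^ 2 * μ * X) < ε := by
    have : Tendsto (fun μ : ℝ => (C + 1) * μ * X + √(C ^ 2 * μ * X) + √(C ^ 2 * μ * X)) (𝓝[>] 0)
        (𝓝 ((C + 1) * 0 * X + √(C ^ 2 * 0 * X) + √(C ^ 2 * 0 * X))) :=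
      ((Continuous.tendsto (by fun_prop) 0).mono_left nhdsWithin_le_nhds)
    simp only [Real.sqrt_zero, mul_zero, zero_mul, add_zero] at this
    obtain ⟨μ, h1, h2, h3⟩ := ((this.eventually_lt_const hε).and
      (Ioc_mem_nhdsGT zero_lt_one)).exists
    exact ⟨μ, h2, h3, h1⟩
  obtain ⟨l, hl⟩ := exists_isPath hμ h
  obtain ⟨x, hx, D, E, -, -, hD, hE, hZ⟩ := key hμ.le hμ1 le_rfl hl
  refine ⟨x, hx, ?_⟩
  rw [dist_comm, dist_eq_norm]
  have e : x - (N.g r s - 1) = (x - (N.g r s - 1) - D - star E) + D + star E := by abel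
  rw [e]
  refine ((norm_add_le _ _).trans (add_le_add ((norm_add_le _ _).trans (add_le_add hZ
    (Real.le_sqrt_of_sq_le hD))) ((norm_star _).trans_le (Real.le_sqrt_of_sq_le hE)))).trans_lt hμε

end FreeNoise

namespace FullFock

variable {H : Type u} [NormedAddCommGroup H] [InnerProductSpace ℂ H]

/-! ## Creation and annihilation operators -/

theorem add_tens (h g : H) {n : ℕ} (y : HilbertPow H n) :
    tens (h + g) y = tens h y + tens g y := by
  unfold tens
  rw [TensorProduct.add_tmul]
  exact Completion.coe_add _ _

theorem smul_tens (c : ℂ) (h : H) {n : ℕ} (y : HilbertPow H n) :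
    tens (c • h) y = c • tens h y := by
  unfold tens
  rw [← TensorProduct.smul_tmul']
  exact Completion.coe_smul _ _

theorem creation_add (h g : H) : creation (h + g) = creation h + creation g := by
  ext1 ξ
  apply lp.ext; funext n
  cases n with
  | zero => change (0 : HilbertPow H 0) = 0 + 0; simp
  | succ n => exact add_tens h g (ξ n)

theorem creation_smul (c : ℂ) (h : H) : creation (c • h) = c • creation h := by
  ext1 ξ
  apply lp.ext; funext n
  cases n with
  | zero => change (0 : HilbertPow H 0) = c • 0; simp
  | succ n => exact smul_tens c h (ξ n)

theorem creation_neg (h : H) : creation (-h) = -creation h := by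
  rw [← neg_one_smul ℂ h, creation_smul, neg_one_smul]

theorem star_creation (h : H) : star (creation h) = annihilation h := rfl

theorem annihilation_neg (h : H) : annihilation (-h) = -annihilation h := by
  rw [← star_creation, ← star_creation, creation_neg, star_neg]

theorem inner_creation_creation (h g : H) (ξ ζ : FullFock H) :
    inner ℂ (creation h ξ) (creation g ζ) = inner ℂ h g * inner ℂ ξ ζ := by
  have h1 := lp.hasSum_inner (𝕜 := ℂ) (creation h ξ) (creation g ζ)
  have h2 : HasSum (fun n => inner ℂ (creation h ξ (n + 1)) (creation g ζ (n + 1)))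
      (inner ℂ h g * inner ℂ ξ ζ) := by
    refine ((lp.hasSum_inner (𝕜 := ℂ) ξ ζ).mul_left (inner ℂ h g)).congr_fun fun n => ?_
    exact inner_tens _ _ _ _
  have h3 := (hasSum_nat_add_iff
    (f := fun n => inner ℂ (creation h ξ n) (creation g ζ n)) 1).1 h2
  have h0 : inner ℂ (creation h ξ 0) (creation g ζ 0) = 0 :=
    inner_zero_left (0 : HilbertPow H 0)
  rw [Finset.sum_range_one, h0, add_zero] at h3
  exact h1.unique h3

theorem annihilation_mul_creation (h g : H) :
    annihilation h * creation g = (inner ℂ h g : ℂ) • (1 : FullFock H →L[ℂ] FullFock H) := by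
  ext1 ζ
  refine ext_inner_left ℂ fun ξ => ?_
  change inner ℂ ξ (annihilation h (creation g ζ)) = inner ℂ ξ ((inner ℂ h g : ℂ) • ζ)
  rw [annihilation, ContinuousLinearMap.adjoint_inner_right, inner_creation_creation,
    inner_smul_right]

end FullFock

/-! ## The one-particle vectors -/

section chi

theorem chiTensor_add (r s : ℝ) (v w : D) :
    chiTensor r s (v + w) = chiTensor r s v + chiTensor r s w := by
  unfold chiTensor
  rw [Completion.coe_add, indicatorConstLp_add]

theorem chiTensor_neg (r s : ℝ) (v : D) : chiTensor r s (-v) = -chiTensor r s v := by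
  have h := chiTensor_add r s v (-v)
  have h0 : chiTensor r s (0 : D) = 0 := by simpa using chiTensor_add r s (0 : D) 0
  rw [add_neg_cancel, h0] at h
  exact (neg_eq_of_add_eq_zero_right h.symm).symm

theorem inner_chiTensor (a b c e : ℝ) (v w : D) :
    inner ℂ (chiTensor a b v) (chiTensor c e w)
      = (((volume.restrict (Set.Ici (0 : ℝ))).real (Set.Icc a b ∩ Set.Icc c e) : ℝ) : ℂ)
        * inner ℂ v w := by
  have hfin : ∀ x y : ℝ, volume.restrict (Set.Ici (0 : ℝ)) (Set.Icc x y) ≠ ⊤ := fun x y =>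
    ne_top_of_le_ne_top measure_Icc_lt_top.ne (Measure.restrict_apply_le _ _)
  refine (L2.inner_indicatorConstLp_indicatorConstLp (𝕜 := ℂ) measurableSet_Icc measurableSet_Icc
    (hfin a b) (hfin c e) (v : Completion D) (w : Completion D)).trans ?_
  rw [Completion.inner_coe, Complex.real_smul]

theorem real_restrict_Icc_le {a b : ℝ} (h : a ≤ b) :
    (volume.restrict (Set.Ici (0 : ℝ))).real (Set.Icc a b) ≤ b - a := by
  rw [← Real.volume_real_Icc_of_le h]
  exact ENNReal.toReal_mono (measure_Icc_lt_top).ne (Measure.restrict_apply_le _ _)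

theorem real_restrict_Icc {a b : ℝ} (ha : 0 ≤ a) (h : a ≤ b) :
    (volume.restrict (Set.Ici (0 : ℝ))).real (Set.Icc a b) = b - a := by
  rw [measureReal_restrict_apply measurableSet_Icc, Set.inter_eq_left.2, Real.volume_real_Icc_of_le h]
  exact fun x hx => ha.trans hx.1

theorem chiTensor_add_interval {a b c : ℝ} (h1 : a ≤ b) (h2 : b ≤ c) (v : D) :
    chiTensor a c v = chiTensor a b v + chiTensor b c v := by
  apply Lp.ext
  unfold chiTensor
  -- The closed intervals overlap only at b, a null set.
  have hb : ∀ᵐ x ∂(volume.restrict (Set.Ici (0 : ℝ))), x ≠ b :=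
    ae_restrict_of_ae (Measure.ae_ne volume b)
  filter_upwards [hb, indicatorConstLp_coeFn (p := 2) (μ := volume.restrict (Set.Ici (0 : ℝ)))
      (s := Set.Icc a c) (hs := measurableSet_Icc)
      (hμs := (ne_top_of_le_ne_top measure_Icc_lt_top.ne (Measure.restrict_apply_le _ _)))
      (c := (v : Completion D)),
    indicatorConstLp_coeFn (p := 2) (μ := volume.restrict (Set.Ici (0 : ℝ)))
      (s := Set.Icc a b) (hs := measurableSet_Icc)
      (hμs := (ne_top_of_le_ne_top measure_Icc_lt_top.ne (Measure.restrict_apply_le _ _)))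
      (c := (v : Completion D)),
    indicatorConstLp_coeFn (p := 2) (μ := volume.restrict (Set.Ici (0 : ℝ)))
      (s := Set.Icc b c) (hs := measurableSet_Icc)
      (hμs := (ne_top_of_le_ne_top measure_Icc_lt_top.ne (Measure.restrict_apply_le _ _)))
      (c := (v : Completion D)), Lp.coeFn_add (chiTensor a b v) (chiTensor b c v)]
    with x hx e1 e2 e3 e4
  unfold chiTensor at e4
  rw [e4, e1, Pi.add_apply, e2, e3]
  by_cases h3 : x < b
  · have h4 : x ∉ Set.Icc b c := fun h => absurd h.1 (not_le.2 h3)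
    have h5 : x ∈ Set.Icc a c ↔ x ∈ Set.Icc a b :=
      ⟨fun h => ⟨h.1, h3.le⟩, fun h => ⟨h.1, h.2.trans h2⟩⟩
    rw [Set.indicator_of_notMem h4, add_zero]
    simp only [Set.indicator, h5]
  · have h3' : b < x := lt_of_le_of_ne (not_lt.1 h3) (Ne.symm hx)
    have h4 : x ∉ Set.Icc a b := fun h => absurd h.2 (not_le.2 h3')
    have h5 : x ∈ Set.Icc a c ↔ x ∈ Set.Icc b c :=
      ⟨fun h => ⟨h3'.le, h.2⟩, fun h => ⟨h1.trans h.1, h.2⟩⟩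
    rw [Set.indicator_of_notMem h4, zero_add]
    simp only [Set.indicator, h5]

theorem real_restrict_inter {a b c e : ℝ} (hbc : b ≤ c) :
    (volume.restrict (Set.Ici (0 : ℝ))).real (Set.Icc a b ∩ Set.Icc c e) = 0 := by
  refine measureReal_eq_zero_iff ?_ |>.2 ?_
  · exact ne_top_of_le_ne_top measure_Icc_lt_top.ne
      ((measure_mono Set.inter_subset_left).trans (Measure.restrict_apply_le _ _))
  · refine le_antisymm ((measure_mono (t := {c}) ?_).trans ((Measure.restrict_apply_le _ _).trans
      (by simp))) zero_le
    rintro x ⟨h1, h2⟩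
    exact le_antisymm (h1.2.trans hbc) h2.1

end chi

/-! ## Schürmann triples with trivial representation -/

namespace SchurmannTriple

variable (T : SchurmannTriple d D)

theorem η_one : T.η 1 = 0 := by
  have h := T.η_mul 1 1
  simp only [mul_one, map_one, one_smul] at h
  have h2 : ((T.η 1 : D) : Completion D) = ((0 : D) : Completion D) := by
    simpa using h
  exact Completion.coe_injective D h2

variable {T}

/-- Apply η to the (l, k) entry of XX^* = E: the cocycle rule with ρ = δ on the generators leaves
η(x_kl^*) + η(x_lk) = 0. Hence the annihilation part of the white noise is -B^*. -/
theorem η_star_x (hρ : ∀ k l : Fin d, T.ρ (KD.x k l) = if k = l then 1 else 0) (k l : Fin d) :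
    T.η (star (KD.x k l)) = -T.η (KD.x l k) := by
  have h := congrArg (fun b => (T.η b : Completion D)) (KD.x_mul_star_x (d := d) l k)
  have e : (T.η (if l = k then (1 : KD d) else 0) : Completion D) = 0 := by
    split_ifs <;> simp [T.η_one]
  simp only [map_sum] at h
  rw [e] at h
  have h2 : ((∑ p, T.η (KD.x l p * star (KD.x k p)) : D) : Completion D)
      = ∑ p, (T.η (KD.x l p * star (KD.x k p)) : Completion D) :=
    map_sum (Completion.toComplL (𝕜 := ℂ) (E := D)) _ _
  rw [h2] at h
  simp only [T.η_mul, map_star, KD.counit_x, hρ, Finset.sum_add_distrib] at h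
  have h3 : ∑ p, (if l = p then (1 : Completion D →L[ℂ] Completion D) else 0)
      (T.η (star (KD.x k p)) : Completion D) = (T.η (star (KD.x k l)) : Completion D) := by
    rw [Finset.sum_eq_single l] <;> simp +contextual [eq_comm]
  have h4 : ∑ p, star (if k = p then (1 : ℂ) else 0) • (T.η (KD.x l p) : Completion D)
      = (T.η (KD.x l k) : Completion D) := by
    rw [Finset.sum_eq_single k] <;> simp +contextual [eq_comm]
  rw [h3, h4, ← Completion.coe_add] at h
  exact eq_neg_of_add_eq_zero_left (Completion.coe_injective D (h.trans Completion.coe_zero.symm))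

theorem ρ_eq_counit (hρ : ∀ k l : Fin d, T.ρ (KD.x k l) = if k = l then 1 else 0) (b : KD d) :
    T.ρ b = KD.counit b • 1 := by
  have h : T.ρ.toAlgHom = (Algebra.ofId ℂ _).comp (KD.counit (d := d)).toAlgHom := by
    refine KD.algHom_ext fun i => ?_
    change T.ρ _ = algebraMap ℂ _ (KD.counit _)
    obtain ⟨k, l, e⟩ := i
    cases e with
    | false =>
      change T.ρ (KD.x k l) = algebraMap ℂ _ (KD.counit (KD.x k l))
      rw [hρ, KD.counit_x]; split_ifs <;> simp
    | true =>
      rw [← KD.star_x, map_star, map_star, hρ, KD.counit_x]; split_ifs <;> simp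
  have := DFunLike.congr_fun h b
  rw [← Algebra.algebraMap_eq_smul_one]
  exact this

/-- The values of the cocycle on the generators span `D`. -/
theorem span_η (hρ : ∀ k l : Fin d, T.ρ (KD.x k l) = if k = l then 1 else 0) :
    Submodule.span ℂ (Set.range fun p : Fin d × Fin d => T.η (KD.x p.1 p.2)) = ⊤ := by
  set V := Submodule.span ℂ (Set.range fun p : Fin d × Fin d => T.η (KD.x p.1 p.2)) with hV
  have hx : ∀ k l, T.η (KD.x k l) ∈ V := fun k l => Submodule.subset_span ⟨(k, l), rfl⟩
  have key : ∀ a : FreeAlgebra ℂ (UnitaryGroup.Gen d), T.η (KD.mk a) ∈ V := by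
    intro a
    induction a using FreeAlgebra.induction with
    | grade0 c =>
      rw [AlgHom.commutes, Algebra.algebraMap_eq_smul_one, map_smul, T.η_one, smul_zero]
      exact zero_mem _
    | grade1 i =>
      obtain ⟨k, l, e⟩ := i
      cases e with
      | false => exact hx k l
      | true =>
        change T.η (KD.gen (k, l, true)) ∈ V
        rw [← KD.star_x, η_star_x hρ]
        exact neg_mem (hx l k)
    -- With ρ = δ the cocycle is a derivation over the counit: η(ab) = δ(a)η(b) + δ(b)η(a).
    | mul a b ha hb =>
      have h := T.η_mul (KD.mk a) (KD.mk b)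
      rw [ρ_eq_counit hρ] at h
      have h2 : T.η (KD.mk a * KD.mk b)
          = KD.counit (KD.mk a) • T.η (KD.mk b) + KD.counit (KD.mk b) • T.η (KD.mk a) := by
        apply Completion.coe_injective D
        rw [h, Completion.coe_add, Completion.coe_smul, Completion.coe_smul]
        rfl
      rw [map_mul, h2]
      exact add_mem (V.smul_mem _ hb) (V.smul_mem _ ha)
    | add a b ha hb => rw [map_add, map_add]; exact add_mem ha hb
  rw [eq_top_iff]
  rintro v -
  obtain ⟨b, rfl⟩ := T.η_surjective v
  obtain ⟨a, rfl⟩ := RingQuot.mkAlgHom_surjective ℂ (UnitaryGroup.Rel d) b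
  exact key a

/-- Infinitesimal unitarity: by X^*X = E, the sum over p of (x_pk - δ_pk)^*(x_pl - δ_pl) equals
2δ_kl - x_lk^* - x_kl, and Ψ kills constants. -/
theorem sum_inner_η (T : SchurmannTriple d D) (k l : Fin d) :
    ∑ p, inner ℂ (T.η (KD.x p k)) (T.η (KD.x p l))
      + (T.Ψ (KD.x k l) + star (T.Ψ (KD.x l k))) = 0 := by
  simp only [T.inner_η, ← map_sum]
  have e : ∑ p, star (KD.x p k - KD.counit (KD.x p k) • (1 : KD d))
      * (KD.x p l - KD.counit (KD.x p l) • 1)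
      = (if k = l then (2 : ℂ) else 0) • (1 : KD d) - star (KD.x l k) - KD.x k l := by
    have h1 : ∀ p, star (KD.x p k - KD.counit (KD.x p k) • (1 : KD d))
        * (KD.x p l - KD.counit (KD.x p l) • 1)
        = star (KD.x p k) * KD.x p l - (if p = l then star (KD.x p k) else 0)
          - (if p = k then KD.x p l else 0)
          + (if p = k then (if p = l then 1 else 0) else 0) := by
      intro p
      simp only [KD.counit_x, star_sub]
      split_ifs <;> simp [sub_mul, mul_sub]
      abel
    rw [Finset.sum_congr rfl fun p _ => h1 p]
    simp only [Finset.sum_add_distrib, Finset.sum_sub_distrib, KD.star_x_mul_x]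
    simp only [Finset.sum_ite_eq', Finset.mem_univ, if_true]
    split_ifs
    · rw [two_smul]; abel
    · simp
  rw [e, map_sub, map_sub, map_smul, T.isGenerator.map_one, T.isGenerator.hermitian]
  rw [smul_zero]
  ring

end SchurmannTriple

/-! ## The white noise -/

section noise

/-- Matrices whose entries are multiples of the identity. -/
def scalarMatrices (d : ℕ) (A : Type*) [CStarAlgebra A] :
    StarSubalgebra ℂ (CStarMatrix (Fin d) (Fin d) A) where
  carrier := {s | ∀ k l, ∃ c : ℂ, s k l = c • 1}
  mul_mem' {s t} hs ht k l := by
    choose f hf using hs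
    choose g hg using ht
    refine ⟨∑ p, f k p * g p l, ?_⟩
    rw [CStarMatrix.mul_apply, Finset.sum_smul]
    refine Finset.sum_congr rfl fun p _ => ?_
    rw [hf, hg, smul_mul_smul_comm, one_mul]
  add_mem' {s t} hs ht k l := by
    obtain ⟨c, hc⟩ := hs k l
    obtain ⟨e, he⟩ := ht k l
    exact ⟨c + e, by rw [CStarMatrix.add_apply, hc, he, add_smul]⟩
  algebraMap_mem' c k l := by
    rw [Algebra.algebraMap_eq_smul_one, CStarMatrix.smul_apply, CStarMatrix.one_apply]
    split_ifs
    · exact ⟨c, rfl⟩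
    · exact ⟨0, by simp⟩
  star_mem' {s} hs k l := by
    obtain ⟨c, hc⟩ := hs l k
    exact ⟨star c, by rw [CStarMatrix.star_apply, hc, star_smul, star_one]⟩

variable (T : SchurmannTriple d D)

/-- The matrix of creation operators. -/
def creationMatrix (a b : ℝ) : CStarMatrix (Fin d) (Fin d) (FockOp D) :=
  CStarMatrix.ofMatrix (Matrix.of fun k l => FullFock.creation (chiTensor a b (T.η (KD.x k l))))

/-- The matrix of drift coefficients. -/
def driftMatrix : CStarMatrix (Fin d) (Fin d) (FockOp D) :=
  CStarMatrix.ofMatrix (Matrix.of fun k l => T.Ψ (KD.x k l) • 1)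

/-- The matrix with entries `∑ p, ⟨η(x_{pk}), η(x_{pl})⟩`. -/
def gramMatrix : CStarMatrix (Fin d) (Fin d) (FockOp D) :=
  CStarMatrix.ofMatrix (Matrix.of fun k l =>
    (∑ p, inner ℂ (T.η (KD.x p k)) (T.η (KD.x p l)) : ℂ) • 1)

theorem star_creationMatrix_mul (a b : ℝ) :
    star (creationMatrix T a b) * creationMatrix T a b
      = (((volume.restrict (Set.Ici (0 : ℝ))).real (Set.Icc a b) : ℝ) : ℂ) • gramMatrix T := by
  refine CStarMatrix.ext fun k l => ?_
  rw [CStarMatrix.mul_apply, CStarMatrix.smul_apply]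
  change ∑ p : Fin d, FullFock.annihilation _ * FullFock.creation _ =
    (_ : ℂ) • ((_ : ℂ) • (1 : FockOp D))
  simp only [FullFock.annihilation_mul_creation, inner_chiTensor, Set.inter_self]
  rw [smul_smul, ← Finset.sum_smul, Finset.mul_sum]

theorem gramMatrix_add : gramMatrix T + (driftMatrix T + star (driftMatrix T)) = 0 := by
  refine CStarMatrix.ext fun k l => ?_
  rw [CStarMatrix.add_apply, CStarMatrix.add_apply, CStarMatrix.star_apply]
  change (_ : ℂ) • (1 : FockOp D) + ((_ : ℂ) • (1 : FockOp D) + star ((_ : ℂ) • (1 : FockOp D))) = 0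
  rw [star_smul, star_one, ← add_smul, ← add_smul, T.sum_inner_η, zero_smul]

/-- The noise of a Schürmann triple. -/
def fockNoise : FreeNoise (CStarMatrix (Fin d) (Fin d) (FockOp D)) where
  scalars := scalarMatrices d (FockOp D)
  B := creationMatrix T
  ψ := driftMatrix T
  K := 1 + ‖gramMatrix T‖ + ‖driftMatrix T‖
  -- At negative times part of the interval is cut off by the half-line and B^*B is too small, so
  -- `unit` is asked only for times in `dom`; the other relations hold for all times, as time
  -- reversal requires.
  dom := Set.Ici 0
  ψ_mem k l := ⟨T.Ψ (KD.x k l), rfl⟩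
  B_add {a b c} h1 h2 := by
    refine CStarMatrix.ext fun k l => ?_
    rw [CStarMatrix.add_apply]
    change FullFock.creation _ = FullFock.creation _ + FullFock.creation _
    rw [chiTensor_add_interval h1 h2, FullFock.creation_add]
  orth {a b c e} h1 h2 h3 s hs := by
    refine CStarMatrix.ext fun k l => ?_
    rw [CStarMatrix.mul_apply]
    refine Finset.sum_eq_zero fun q _ => ?_
    rw [CStarMatrix.mul_apply (M := star (creationMatrix T a b)), Finset.sum_mul]
    refine Finset.sum_eq_zero fun p _ => ?_
    obtain ⟨σ, hσ⟩ := hs p q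
    rw [hσ]
    change FullFock.annihilation _ * (σ • 1) * FullFock.creation _ = (0 : FockOp D)
    rw [mul_smul_comm, mul_one, smul_mul_assoc, FullFock.annihilation_mul_creation,
      inner_chiTensor, real_restrict_inter h2]
    simp
  one_le_K := by
    have := norm_nonneg (gramMatrix T)
    have := norm_nonneg (driftMatrix T)
    linarith
  norm_B_sq {a b} h := by
    rw [sq, ← CStarRing.norm_star_mul_self, star_creationMatrix_mul,
      FreeNoise.norm_ofReal_smul measureReal_nonneg, mul_comm]
    have := norm_nonneg (driftMatrix T)
    exact mul_le_mul (by linarith) (real_restrict_Icc_le h) measureReal_nonneg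
      (by positivity)
  norm_ψ := by
    have := norm_nonneg (gramMatrix T)
    linarith
  unit {a b} ha hb h := by
    rw [star_creationMatrix_mul, real_restrict_Icc ha h, ← smul_add, gramMatrix_add, smul_zero]

variable {T}

theorem ofMatrix_whiteNoiseMatrix
    (hρ : ∀ k l : Fin d, T.ρ (KD.x k l) = if k = l then 1 else 0) (a b : ℝ) :
    CStarMatrix.ofMatrix (whiteNoiseMatrix T a b) = (fockNoise T).g a b := by
  refine CStarMatrix.ext fun k l => ?_
  change (if k = l then 1 else 0) + FullFock.creation (chiTensor a b (T.η (KD.x k l)))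
    + FullFock.annihilation (chiTensor a b (T.η (star (KD.x k l))))
    + (((b - a : ℝ) : ℂ) * T.Ψ (KD.x k l)) • (1 : FockOp D)
    = (if k = l then 1 else 0) + ((b - a : ℝ) : ℂ) • (T.Ψ (KD.x k l) • (1 : FockOp D))
      - FullFock.annihilation (chiTensor a b (T.η (KD.x l k)))
      + FullFock.creation (chiTensor a b (T.η (KD.x k l)))
  rw [SchurmannTriple.η_star_x hρ, chiTensor_neg, FullFock.annihilation_neg, smul_smul]
  abel

theorem ofMatrix_Theta
    (hρ : ∀ k l : Fin d, T.ρ (KD.x k l) = if k = l then 1 else 0) {r s : ℝ}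
    (α : IntervalPartition r s) :
    CStarMatrix.ofMatrix (Theta T α) = α.prod (fockNoise T).g := by
  have e : (fockNoise T).g = fun a b => CStarMatrix.ofMatrix (whiteNoiseMatrix T a b) := by
    funext a b; rw [ofMatrix_whiteNoiseMatrix hρ]
  rw [e]
  unfold Theta IntervalPartition.prod
  change CStarMatrix.ofMatrixRingEquiv _ = _
  rw [map_list_prod, List.map_zipWith]
  rfl

end noise

/-! ## Density of step functions -/

theorem setIntegral_eq_zero_of_inner_chiTensor {f : OneParticle D} {r s : ℝ}
    (h : ∀ v : D, inner ℂ (chiTensor r s v) f = 0) :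
    ∫ x in Set.Icc r s, f x ∂(volume.restrict (Set.Ici (0 : ℝ))) = 0 := by
  have key : ∀ c : Completion D,
      inner ℂ c (∫ x in Set.Icc r s, f x ∂(volume.restrict (Set.Ici (0 : ℝ)))) = 0 := by
    intro c
    induction c using Completion.induction_on with
    | hp => exact isClosed_eq (by fun_prop) continuous_const
    | ih v =>
      rw [← L2.inner_indicatorConstLp_eq_inner_setIntegral ℂ measurableSet_Icc
        (ne_top_of_le_ne_top measure_Icc_lt_top.ne (Measure.restrict_apply_le _ _))]
      exact h v
  exact inner_self_eq_zero.1 (key _)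

theorem eq_zero_of_inner_chiTensor {f : OneParticle D}
    (h : ∀ r s : ℝ, 0 ≤ r → r ≤ s → ∀ v : D, inner ℂ (chiTensor r s v) f = 0) : f = 0 := by
  set μ := volume.restrict (Set.Ici (0 : ℝ)) with hμ
  have h1 : ∀ r s : ℝ, 0 ≤ r → r ≤ s → ∫ x in Set.Icc r s, f x ∂μ = 0 := fun r s hr hrs =>
    setIntegral_eq_zero_of_inner_chiTensor (h r s hr hrs)
  have h2 : ∀ n : ℕ, f =ᵐ[μ.restrict (Set.Icc 0 (n : ℝ))] 0 := by
    intro n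
    have : IsFiniteMeasure (μ.restrict (Set.Icc 0 (n : ℝ))) :=
      ⟨by
        rw [Measure.restrict_apply_univ]
        exact (Measure.restrict_apply_le _ _).trans_lt measure_Icc_lt_top⟩
    have hint : Integrable f (μ.restrict (Set.Icc 0 (n : ℝ))) :=
      ((Lp.memLp f).restrict _).integrable one_le_two
    refine hint.ae_eq_zero_of_forall_setIntegral_eq_zero fun t ht _ => ?_
    -- The half-lines Iic a form a π-system generating the Borel sets and meet [0, n] in an interval
    -- from 0 or in the empty set.
    induction t, ht using MeasurableSpace.induction_on_inter
      (BorelSpace.measurable_eq.trans (borel_eq_generateFrom_Iic ℝ)) isPiSystem_Iic with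
    | empty => simp
    | basic t ht =>
      obtain ⟨a, rfl⟩ := ht
      rw [Measure.restrict_restrict measurableSet_Iic]
      rcases le_or_gt 0 a with ha | ha
      · have e : Set.Iic a ∩ Set.Icc 0 (n : ℝ) = Set.Icc 0 (min a n) := by
          ext x; simp only [Set.mem_inter_iff, Set.mem_Iic, Set.mem_Icc, le_min_iff]; tauto
        rw [e]
        exact h1 _ _ le_rfl (le_min ha n.cast_nonneg)
      · have e : Set.Iic a ∩ Set.Icc 0 (n : ℝ) = ∅ := by
          ext x
          simp only [Set.mem_inter_iff, Set.mem_Iic, Set.mem_Icc, Set.mem_empty_iff_false, iff_false]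
          rintro ⟨h3, h4, -⟩
          linarith
        rw [e]; simp
    | compl t ht ih =>
      rw [setIntegral_compl ht hint, ih (measure_lt_top _ _), sub_zero]
      exact h1 _ _ le_rfl n.cast_nonneg
    | iUnion g hd hg ih =>
      rw [integral_iUnion hg hd hint.integrableOn]
      simp [fun i => ih i (measure_lt_top _ _)]
  have h3 : ∀ᵐ x ∂μ, ∀ n : ℕ, x ∈ Set.Icc 0 (n : ℝ) → f x = 0 :=
    ae_all_iff.2 fun n => (ae_restrict_iff' measurableSet_Icc).1 (h2 n)
  apply Lp.ext
  filter_upwards [h3, ae_restrict_mem (μ := volume) (measurableSet_Ici (a := (0 : ℝ))),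
    Lp.coeFn_zero (Completion D) 2 μ] with x hx hx0 hz
  obtain ⟨n, hn⟩ := exists_nat_ge x
  rw [hx n ⟨hx0, hn⟩, hz]; rfl

/-- The one-particle vectors of the cocycle are total. -/
theorem closure_span_chiTensor {T : SchurmannTriple d D}
    (hρ : ∀ k l : Fin d, T.ρ (KD.x k l) = if k = l then 1 else 0) :
    (Submodule.span ℂ {h : OneParticle D | ∃ (r s : ℝ) (k l : Fin d), 0 ≤ r ∧ r ≤ s ∧
      h = chiTensor r s (T.η (KD.x k l))}).topologicalClosure = ⊤ := by
  rw [Submodule.topologicalClosure_eq_top_iff, Submodule.eq_bot_iff]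
  intro f hf
  refine eq_zero_of_inner_chiTensor fun r s hr hrs v => ?_
  have hv : v ∈ Submodule.span ℂ (Set.range fun p : Fin d × Fin d => T.η (KD.x p.1 p.2)) := by
    rw [SchurmannTriple.span_η hρ]; trivial
  induction hv using Submodule.span_induction with
  | mem v hv =>
    obtain ⟨p, rfl⟩ := hv
    refine (Submodule.mem_orthogonal _ f).1 hf _ (Submodule.subset_span ?_)
    exact ⟨r, s, p.1, p.2, hr, hrs, rfl⟩
  | zero =>
    have h0 : chiTensor r s (0 : D) = 0 := by simpa using chiTensor_add r s (0 : D) 0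
    rw [h0, inner_zero_left]
  | add v w _ _ hv hw => rw [chiTensor_add, inner_add_left, hv, hw, add_zero]
  | smul c v _ hv =>
    have : chiTensor r s (c • v) = c • chiTensor r s v := by
      apply Lp.ext
      unfold chiTensor
      filter_upwards [indicatorConstLp_coeFn (p := 2) (μ := volume.restrict (Set.Ici (0 : ℝ)))
          (s := Set.Icc r s) (hs := measurableSet_Icc)
          (hμs := (ne_top_of_le_ne_top measure_Icc_lt_top.ne (Measure.restrict_apply_le _ _)))
          (c := ((c • v : D) : Completion D)),
        indicatorConstLp_coeFn (p := 2) (μ := volume.restrict (Set.Ici (0 : ℝ)))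
          (s := Set.Icc r s) (hs := measurableSet_Icc)
          (hμs := (ne_top_of_le_ne_top measure_Icc_lt_top.ne (Measure.restrict_apply_le _ _)))
          (c := (v : Completion D)),
        Lp.coeFn_smul c (chiTensor r s v)] with x e1 e2 e3
      unfold chiTensor at e3
      rw [e3, e1, Pi.smul_apply, e2, Completion.coe_smul]
      simp only [Set.indicator]
      split_ifs <;> simp
    rw [this, inner_smul_left, hv, mul_zero]

/-! ## Cyclicity of the vacuum for field operators -/

namespace FullFock

variable {H : Type u} [NormedAddCommGroup H] [InnerProductSpace ℂ H]

theorem eq_top_of_tens_mem {n : ℕ} {V : Submodule ℂ (HilbertPow H (n + 1))}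
    (hV : IsClosed (V : Set (HilbertPow H (n + 1)))) (h : ∀ g (y : HilbertPow H n), tens g y ∈ V)
    (z : HilbertPow H (n + 1)) : z ∈ V := by
  refine Completion.induction_on (p := fun z => z ∈ V) z hV fun a => ?_
  induction a using TensorProduct.induction_on with
  | zero => exact V.zero_mem
  | tmul g y => exact h g y
  | add a b ha hb => exact (congrArg (· ∈ V) (Completion.coe_add a b)).mpr (V.add_mem ha hb)

theorem eq_smul_scalar (y : HilbertPow H 0) : ∃ c : ℂ, y = c • scalar 1 := by
  have h : ∀ y : EuclideanSpace ℂ PUnit.{u + 1}, ∃ c : ℂ,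
      y = c • EuclideanSpace.single PUnit.unit (1 : ℂ) := fun y =>
    ⟨y PUnit.unit, by ext i; simp⟩
  exact h y

/-- A closed subspace containing the vacuum and stable under field operators
`A^*(h) + A(w)` for a total set of `h` is everything. -/
theorem eq_top_of_field_mem {N : Submodule ℂ (FullFock H)} (hN : IsClosed (N : Set (FullFock H)))
    (hΩ : vacuum ∈ N) {V : Set H} (hV : (Submodule.span ℂ V).topologicalClosure = ⊤)
    (h : ∀ v ∈ V, ∃ w : H, ∀ ξ ∈ N, creation v ξ + annihilation w ξ ∈ N) : N = ⊤ := by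
  let sing : ∀ n, HilbertPow H n →L[ℂ] FullFock H := fun n =>
    lp.singleContinuousLinearMap ℂ (fun n => HilbertPow H n) 2 n
  have hclosed : ∀ n, IsClosed ((N.comap (sing n).toLinearMap : Submodule ℂ _) :
      Set (HilbertPow H n)) := fun n => hN.preimage (sing n).continuous
  -- Both claims are needed at once: knowing that annihilators map degree n into N allows the
  -- creation term to be isolated from the field operator, which gives degree n + 1.
  have key : ∀ n, (∀ y : HilbertPow H n, sing n y ∈ N) ∧
      ∀ (w : H) (y : HilbertPow H n), annihilation w (sing n y) ∈ N := by
    intro n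
    induction n with
    | zero =>
      have h1 : ∀ y : HilbertPow H 0, ∃ c : ℂ, sing 0 y = c • vacuum := by
        intro y
        obtain ⟨c, rfl⟩ := eq_smul_scalar y
        exact ⟨c, by rw [map_smul]; rfl⟩
      constructor
      · intro y
        obtain ⟨c, hc⟩ := h1 y
        rw [hc]; exact N.smul_mem _ hΩ
      · intro w y
        obtain ⟨c, hc⟩ := h1 y
        rw [hc, map_smul, annihilation_vacuum, smul_zero]; exact N.zero_mem
    | succ n ih =>
      obtain ⟨ih1, ih2⟩ := ih
      constructor
      · refine eq_top_of_tens_mem (hclosed (n + 1)) fun g y => ?_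
        change sing (n + 1) (tens g y) ∈ N
        have e : ∀ g : H, sing (n + 1) (tens g y) = creation g (sing n y) := fun g =>
          (creation_single g n y).symm
        let P : Submodule ℂ H :=
          { carrier := {g | creation g (sing n y) ∈ N}
            add_mem' := fun {a b} ha hb => by
              change creation (a + b) _ ∈ N
              rw [creation_add]; exact N.add_mem ha hb
            zero_mem' := by
              change creation 0 _ ∈ N
              rw [← zero_smul ℂ (0 : H), creation_smul, zero_smul]; exact N.zero_mem
            smul_mem' := fun c a ha => by
              change creation (c • a) _ ∈ N
              rw [creation_smul]; exact N.smul_mem _ ha }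
        have hcont : Continuous fun g : H => creation g (sing n y) := by
          let L : H →ₗ[ℂ] FullFock H :=
            { toFun := fun g => creation g (sing n y)
              map_add' := fun a b => by rw [creation_add]; rfl
              map_smul' := fun c a => by rw [creation_smul]; rfl }
          refine (L.mkContinuous ‖sing n y‖ fun g => ?_).continuous
          rw [mul_comm]
          exact (creation g).le_of_opNorm_le (LinearMap.mkContinuous_norm_le _ (norm_nonneg _) _) _
        have hPc : IsClosed (P : Set H) := hN.preimage hcont
        have hVP : Submodule.span ℂ V ≤ P := by
          refine Submodule.span_le.2 fun v hv => ?_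
          obtain ⟨w, hw⟩ := h v hv
          have := N.sub_mem (hw _ (ih1 y)) (ih2 w y)
          rwa [add_sub_cancel_right] at this
        have := Submodule.topologicalClosure_minimal _ hVP hPc
        rw [hV] at this
        rw [e]
        exact this (Submodule.mem_top : g ∈ ⊤)
      · intro w
        have hc : IsClosed ((N.comap ((annihilation w).comp (sing (n + 1))).toLinearMap :
            Submodule ℂ _) : Set (HilbertPow H (n + 1))) :=
          hN.preimage ((annihilation w).comp (sing (n + 1))).continuous
        refine eq_top_of_tens_mem hc fun g y => ?_
        change annihilation w (lp.single 2 (n + 1) (tens g y) : FullFock H) ∈ N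
        rw [annihilation_single]
        exact N.smul_mem _ (ih1 y)
  rw [eq_top_iff]
  rintro ξ -
  have hs := lp.hasSum_single (E := fun n => HilbertPow H n) (p := 2) (by norm_num) ξ
  exact hN.mem_of_tendsto hs (Eventually.of_forall fun s =>
    N.sum_mem fun n _ => (key n).1 (ξ n))

end FullFock

/-! ## The main theorem -/

section main

variable {T : SchurmannTriple d D}

theorem tendsto_ofMatrix {ι : Type*} {l : Filter ι} {f : ι → Matrix (Fin d) (Fin d) (FockOp D)}
    {U : Matrix (Fin d) (Fin d) (FockOp D)} :
    Tendsto (fun i => CStarMatrix.ofMatrix (f i)) l (𝓝 (CStarMatrix.ofMatrix U)) ↔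
      ∀ k m, Tendsto (fun i => f i k m) l (𝓝 (U k m)) := by
  -- The C*-algebra of matrices carries the entrywise topology by definition.
  have h : Tendsto (fun i => CStarMatrix.ofMatrix (f i)) l (𝓝 (CStarMatrix.ofMatrix U)) ↔
      Tendsto f l (𝓝 U) := Iff.rfl
  exact h.trans ⟨fun H k m => tendsto_pi_nhds.1 (tendsto_pi_nhds.1 H k) m,
    fun H => tendsto_pi_nhds.2 fun k => tendsto_pi_nhds.2 fun m => H k m⟩

theorem exists_isFockProcess (hρ : ∀ k l : Fin d, T.ρ (KD.x k l) = if k = l then 1 else 0) :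
    ∃ f : OpFamily d D, IsFockProcess T f := by
  have h1 : ∀ r s : ℝ, 0 ≤ r → r ≤ s → ∃ U : Matrix (Fin d) (Fin d) (FockOp D),
      (∀ k l, Tendsto (fun α : IntervalPartition r s => Theta T α k l) atTop (𝓝 (U k l))) ∧
        U * U.conjTranspose = 1 ∧ U.conjTranspose * U = 1 := by
    intro r s hr hrs
    obtain ⟨U, hU⟩ := (fockNoise T).exists_tendsto hrs
    obtain ⟨hU1, hU2⟩ := FreeNoise.isUnitary_of_tendsto (N := fockNoise T) hrs
      (fun x hx => (hr.trans hx.1 : (0 : ℝ) ≤ x)) hU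
    refine ⟨CStarMatrix.ofMatrix.symm U, ?_, hU1, hU2⟩
    simp only [← ofMatrix_Theta hρ] at hU
    exact tendsto_ofMatrix.1 hU
  choose U hU hU1 hU2 using h1
  refine ⟨fun r s hr hrs => KD.lift (U r s hr hrs) (hU1 r s hr hrs) (hU2 r s hr hrs), ?_, ?_⟩
  · intro r s hr hrs k l
    rw [KD.lift_x]
    exact hU r s hr hrs.le k l
  · intro r hr b
    have := IntervalPartition.neBot_atTop (le_refl r)
    -- The only partition of [r, r] is {r}, whose product is empty.
    have hΘ : ∀ α : IntervalPartition r r, Theta T α = 1 := by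
      intro α
      have h2 := α.isPath
      unfold Theta
      change pathProd _ _ = 1
      generalize α.1.sort (· ≤ ·) = l at h2
      cases h2 with
      | nil => simp
      | cons h3 h4 h5 => exact absurd h5.le (not_le.2 h3)
    have hU' : U r r hr le_rfl = 1 := by
      ext1 k l
      refine tendsto_nhds_unique (hU r r hr le_rfl k l) ?_
      simp only [hΘ]
      exact tendsto_const_nhds
    have h : (KD.lift (U r r hr le_rfl) (hU1 r r hr le_rfl) (hU2 r r hr le_rfl)).toAlgHom
        = (Algebra.ofId ℂ (FockOp D)).comp (KD.counit (d := d)).toAlgHom := by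
      have hx : ∀ k l, KD.lift (U r r hr le_rfl) (hU1 r r hr le_rfl) (hU2 r r hr le_rfl) (KD.x k l)
          = if k = l then 1 else 0 := fun k l => by rw [KD.lift_x, hU', Matrix.one_apply]
      refine KD.algHom_ext fun i => ?_
      change KD.lift _ _ _ _ = algebraMap ℂ _ (KD.counit _)
      obtain ⟨k, l, e⟩ := i
      cases e with
      | false =>
        change KD.lift _ _ _ (KD.x k l) = algebraMap ℂ _ (KD.counit (KD.x k l))
        rw [hx, KD.counit_x]; split_ifs <;> simp
      | true =>
        rw [← KD.star_x, map_star, map_star, hx, KD.counit_x]; split_ifs <;> simp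
    rw [← Algebra.algebraMap_eq_smul_one]
    exact DFunLike.congr_fun h b

theorem IsFockProcess.unique {f g : OpFamily d D} (hf : IsFockProcess T f)
    (hg : IsFockProcess T g) : f = g := by
  funext r s hr hrs
  rcases hrs.eq_or_lt with rfl | hlt
  · exact StarAlgHom.ext fun b => (hf.diag r hr b).trans (hg.diag r hr b).symm
  · have := IntervalPartition.neBot_atTop hrs
    have hx : ∀ k l, f r s hr hrs (KD.x k l) = g r s hr hrs (KD.x k l) := fun k l =>
      tendsto_nhds_unique (hf.tendsto r s hr hlt k l) (hg.tendsto r s hr hlt k l)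
    have h : (f r s hr hrs).toAlgHom = (g r s hr hrs).toAlgHom := by
      refine KD.algHom_ext fun i => ?_
      change f r s hr hrs _ = g r s hr hrs _
      obtain ⟨k, l, e⟩ := i
      cases e with
      | false => exact hx k l
      | true => rw [← KD.star_x, map_star, map_star, hx]
    exact StarAlgHom.ext fun b => DFunLike.congr_fun h b

/-- The field operators belong to the norm closure of the algebra of the process. -/
theorem IsFockProcess.field_mem {f : OpFamily d D} (hf : IsFockProcess T f)
    (hρ : ∀ k l : Fin d, T.ρ (KD.x k l) = if k = l then 1 else 0) {r s : ℝ} (hr : 0 ≤ r)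
    (hrs : r ≤ s) (k l : Fin d) :
    FullFock.creation (chiTensor r s (T.η (KD.x k l)))
      + FullFock.annihilation (chiTensor r s (T.η (star (KD.x k l))))
        ∈ (generatedSubalgebra f).topologicalClosure := by
  set 𝒜 := (generatedSubalgebra f).topologicalClosure with h𝒜
  have hcl : IsClosed (𝒜 : Set (FockOp D)) := StarSubalgebra.isClosed_topologicalClosure _
  classical
  -- The value 0 off 0 ≤ a ≤ b is never used: the intervals involved start at or after r ≥ 0.
  let U : ℝ → ℝ → CStarMatrix (Fin d) (Fin d) (FockOp D) := fun a b =>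
    if h : 0 ≤ a ∧ a ≤ b then CStarMatrix.ofMatrix (Matrix.of fun k l => f a b h.1 h.2 (KD.x k l))
    else 0
  let P : AddSubmonoid (CStarMatrix (Fin d) (Fin d) (FockOp D)) :=
    { carrier := {x | ∀ k l, x k l ∈ 𝒜}
      add_mem' := fun hx hy k l => add_mem (hx k l) (hy k l)
      zero_mem' := fun k l => zero_mem 𝒜 }
  have hone : ∀ k l, (1 : CStarMatrix (Fin d) (Fin d) (FockOp D)) k l ∈ 𝒜 := by
    intro k l
    rw [CStarMatrix.one_apply]
    split_ifs
    · exact one_mem 𝒜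
    · exact zero_mem 𝒜
  have hP' : IsClosed {x : Matrix (Fin d) (Fin d) (FockOp D) | ∀ k l, x k l ∈ 𝒜} := by
    simp only [Set.ofPred_forall]
    exact isClosed_iInter fun k => isClosed_iInter fun l =>
      hcl.preimage ((continuous_apply l).comp (continuous_apply k))
  have hP : IsClosed (P : Set (CStarMatrix (Fin d) (Fin d) (FockOp D))) := hP'
  have hmem := FreeNoise.g_sub_one_mem (N := fockNoise T) hrs (U := U) (fun a b ha hab => by
      have hab' : 0 ≤ a ∧ a ≤ b := ⟨hr.trans ha, hab.le⟩
      have hUab : U a b = CStarMatrix.ofMatrix (Matrix.of fun k l =>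
        f a b hab'.1 hab'.2 (KD.x k l)) := dif_pos hab'
      have e : (fun α : IntervalPartition a b => α.prod (fockNoise T).g)
          = fun α => CStarMatrix.ofMatrix (Theta T α) :=
        funext fun α => (ofMatrix_Theta hρ α).symm
      rw [hUab, e]
      exact tendsto_ofMatrix.2 fun k l => hf.tendsto a b hab'.1 hab k l) P hP (fun a b ha hab => by
      have hab' : 0 ≤ a ∧ a ≤ b := ⟨hr.trans ha, hab.le⟩
      have hUab : U a b = CStarMatrix.ofMatrix (Matrix.of fun k l =>
        f a b hab'.1 hab'.2 (KD.x k l)) := dif_pos hab'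
      intro k l
      rw [hUab, CStarMatrix.sub_apply]
      refine sub_mem (StarSubalgebra.le_topologicalClosure _ (StarAlgebra.subset_adjoin ℂ _ ?_))
        (hone k l)
      exact ⟨a, b, hab'.1, hab'.2, KD.x k l, rfl⟩)
  have h1 := hmem k l
  rw [← ofMatrix_whiteNoiseMatrix hρ, CStarMatrix.sub_apply] at h1
  have h2 : whiteNoiseMatrix T r s k l ∈ 𝒜 := by
    have := add_mem h1 (hone k l)
    rwa [sub_add_cancel] at this
  have h3 : (if k = l then (1 : FockOp D) else 0) ∈ 𝒜 := hone k l
  have h4 : ((((s - r : ℝ) : ℂ) * T.Ψ (KD.x k l)) • (1 : FockOp D)) ∈ 𝒜 :=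
    𝒜.smul_mem (one_mem 𝒜) _
  have h5 := sub_mem (sub_mem h2 h4) h3
  have e : whiteNoiseMatrix T r s k l - (((s - r : ℝ) : ℂ) * T.Ψ (KD.x k l)) • (1 : FockOp D)
      - (if k = l then (1 : FockOp D) else 0)
      = FullFock.creation (chiTensor r s (T.η (KD.x k l)))
      + FullFock.annihilation (chiTensor r s (T.η (star (KD.x k l)))) := by
    unfold whiteNoiseMatrix
    rw [Matrix.of_apply]
    abel
  rwa [e] at h5

/-- The closure of 𝒜Ω is stable under 𝒜, hence under its norm closure, hence under the field
operators of a total set of one-particle vectors. -/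
theorem IsFockProcess.isCyclicFamily {f : OpFamily d D} (hf : IsFockProcess T f)
    (hρ : ∀ k l : Fin d, T.ρ (KD.x k l) = if k = l then 1 else 0) : IsCyclicFamily f := by
  let ev : FockOp D →L[ℂ] FockL2 D := ContinuousLinearMap.apply ℂ (FockL2 D) FullFock.vacuum
  let N₀ : Submodule ℂ (FockL2 D) :=
    (Subalgebra.toSubmodule (generatedSubalgebra f).toSubalgebra).map ev.toLinearMap
  have hset : {ξ : FockL2 D | ∃ a ∈ generatedSubalgebra f, ξ = a FullFock.vacuum} = N₀ := by
    ext ξ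
    constructor
    · rintro ⟨a, ha, rfl⟩; exact ⟨a, ha, rfl⟩
    · rintro ⟨a, ha, rfl⟩; exact ⟨a, ha, rfl⟩
  have hstab₀ : ∀ a ∈ generatedSubalgebra f, ∀ ξ ∈ N₀.topologicalClosure,
      a ξ ∈ N₀.topologicalClosure := by
    intro a ha ξ hξ
    refine map_mem_closure (t := (N₀ : Set (FockL2 D))) a.continuous hξ ?_
    rintro _ ⟨b, hb, rfl⟩
    have hb' : b ∈ generatedSubalgebra f := hb
    have hab : a * b ∈ generatedSubalgebra f := mul_mem ha hb'
    exact ⟨a * b, hab, rfl⟩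
  have hstab : ∀ a ∈ (generatedSubalgebra f).topologicalClosure, ∀ ξ ∈ N₀.topologicalClosure,
      a ξ ∈ N₀.topologicalClosure := by
    intro a ha ξ hξ
    have hc : Continuous fun a : FockOp D => a ξ := by fun_prop
    have := map_mem_closure (t := (N₀.topologicalClosure : Set (FockL2 D))) hc ha
      fun b hb => hstab₀ b hb ξ hξ
    rwa [N₀.isClosed_topologicalClosure.closure_eq] at this
  unfold IsCyclicFamily
  rw [hset, Submodule.dense_iff_topologicalClosure_eq_top]
  refine FullFock.eq_top_of_field_mem N₀.isClosed_topologicalClosure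
    (N₀.le_topologicalClosure ⟨1, one_mem (generatedSubalgebra f), rfl⟩)
    (closure_span_chiTensor hρ) ?_
  rintro _ ⟨r, s, k, l, hr, hrs, rfl⟩
  exact ⟨_, fun ξ hξ => hstab _ (hf.field_mem hρ hr hrs k l) ξ hξ⟩

end main
end

theorem mainTheorem3 (d : ℕ) {D : Type*} [NormedAddCommGroup D] [InnerProductSpace ℂ D]
    (T : SchurmannTriple d D)
    (hρ : ∀ k l : Fin d, T.ρ (KD.x k l) = if k = l then 1 else 0) :
    (∃! f : OpFamily d D, IsFockProcess T f) ∧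
      ∀ f : OpFamily d D, IsFockProcess T f → IsCyclicFamily f := by
  obtain ⟨f, hf⟩ := exists_isFockProcess hρ
  exact ⟨⟨f, hf, fun _ hg => hg.unique hf⟩, fun _ hg => hg.isCyclicFamily hρ⟩
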